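/- Let $L^2=L^2[0,1]$ with norm $\|\cdot\|$, let $\|\cdot\|_\infty$ be the $L^\infty[0,1]$-norm, and let $(\varphi_j)_{j\ge1}$ be an orthonormal system in $L^2$ with closed linear span $\Phi$. Let $(\gamma_j)_{j\ge1}$ be strictly positive weights with $\gamma_1\le1$, let $r>0$, and assume: (A1) there is $\tau_\infty\ge1$ with $\|\sum_{j=1}^m\varphi_j^2\|_\infty\le\tau_\infty^2 m$ for all $m\ge1$; (A2) $(\gamma_j)$ is non-increasing with limit $0$, and there is $A\ge1$ with $\|\sum_{j\ge1}\gamma_j\varphi_j^2\|_\infty\le A^2$. Let $\mathcal F_\gamma^r$ be the set of all $f\in L^2$ with $\sum_{j\ge1}\gamma_j^{-1}\langle f,\varphi_j\rangle^2\le r^2$. For $n,m\ge 1$ put $R_n^m=\max(\gamma_m,m/n)$, let $m_n^*$ be the smallest minimizer of $m\mapsto R_n^m$ over $m\ge1$, and $\delta_n^*=R_n^{m_n^*}=\min_{m\ge1}R_n^m$. Let $(U_i)_{i\in\mathbb Z}$ be a strictly stationary real process whose marginals are uniform on $[0,1]$, and let $(\varepsilon_i)_{i\ge1}$ be i.i.d.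 with mean $0$ and variance $1$, independent of $(U_i)_{i\in\mathbb Z}$. For $\sigma>0$ and $f\in L^2$ one observes $(Y_i,U_i)$, $1\le i\le n$, with $Y_i=f(U_i)+\sigma\varepsilon_i$; let $$\hat f_m=\sum_{j=1}^m\Big(\frac1n\sum_{i=1}^nY_i\varphi_j(U_i)\Big)\varphi_j .$$ For real random variables $X,X'$ let $\beta(X,X')=\tfrac12\sup\sum_i\sum_j|P(B_i)P(C_j)-P(B_i\cap C_j)|$, the supremum being over all finite partitions $(B_i)$ and $(C_j)$ of the probability space into events of $\sigma(X)$ and of $\sigma(X')$, respectively. Assume $\sum_{k\ge1}\beta(U_0,U_k)<\infty$ and (D2) for every $k\ge1$ the pair $(U_0,U_k)$ has a square integrable density $f_{U_0,U_k}$ on $[0,1]^2$, and $\gamma_U:=\sup_{k\ge1}\|f_{U_0,U_k}-1\|_{L^2([0,1]^2)}<\infty$. Then there is an integer $n_o\ge1$ such that $$\sup_{f\in\mathcal F_\gamma^r\cap\Phi}\mathbb E\|\hat f_{m_n^*}-f\|^2\le\big(\sigma^2+(r^2+1)\tau_\infty^2+r^2\big)\,\delta_n^*\qquad\text{for all }n\ge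 n_o.$$ Here $n_o$ depends only on the mixing coefficients $(\beta(U_0,U_k))_{k\ge1}$, the product $rA$, the weights $(\gamma_j)_{j\ge 1}$ and an upper bound for $\gamma_U$. If $(\varphi_j)$ is an orthonormal basis of $L^2$, then $\Phi=L^2$ and the supremum is over all of $\mathcal F_\gamma^r$. -/

import Mathlib

open MeasureTheory ProbabilityTheory Filter Topology
open scoped ENNReal NNReal

noncomputable section

namespace DepReg

/-! ### The Hilbert space `L²[0,1]` -/

/-- The uniform distribution on `[0,1]` (Lebesgue measure restricted to `[0,1]`). -/
def unif : Measure ℝ := (volume : Measure ℝ).restrict (Set.Icc 0 1)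

instance : IsProbabilityMeasure unif := ⟨by simp [unif]⟩

/-- `L²[0,1]`, the square integrable real functions on `[0,1]`. -/
abbrev L2I : Type := Lp ℝ 2 unif

/-- The `L^∞[0,1]` norm of a `[0,∞]`-valued function. -/
def supNorm (h : ℝ → ℝ≥0∞) : ℝ≥0∞ := essSup h unif

/-! ### Assumptions on the orthonormal system and on the weights -/

/-- `‖∑_{j=1}^m φ_j²‖_∞ ≤ τ² m` for all `m ≥ 1`. -/
def CondA1 (φ : ℕ+ → L2I) (τ : ℝ) : Prop :=
  ∀ m : ℕ+, supNorm (fun x => ∑ j ∈ Finset.Icc 1 m, ENNReal.ofReal (φ j x ^ 2))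
    ≤ ENNReal.ofReal (τ ^ 2 * (m : ℕ))

/-- The weights decrease to zero, and `‖∑_{j ≥ 1} w_j φ_j²‖_∞ ≤ A²`. -/
structure CondA2 (w : ℕ+ → ℝ) (φ : ℕ+ → L2I) (A : ℝ) : Prop where
  antitone : Antitone w
  tendsto_zero : Tendsto w atTop (𝓝 0)
  bound : supNorm (fun x => ∑' j, ENNReal.ofReal (w j * φ j x ^ 2)) ≤ ENNReal.ofReal (A ^ 2)

/-! ### The classes of functions -/

/-- The closed linear subspace `Φ` of `L²[0,1]` spanned by the system `φ`. -/
def spanClosure (φ : ℕ+ → L2I) : Submodule ℝ L2I :=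
  (Submodule.span ℝ (Set.range φ)).topologicalClosure

instance (φ : ℕ+ → L2I) : (spanClosure φ).HasOrthogonalProjection :=
  inferInstanceAs
    ((Submodule.span ℝ (Set.range φ)).topologicalClosure).HasOrthogonalProjection

/-- The squared weighted norm `∑_j w_j⁻¹ ⟨φ_j, h⟩²`, with values in `[0,∞]`. -/
def wnormSq (w : ℕ+ → ℝ) (φ : ℕ+ → L2I) (h : L2I) : ℝ≥0∞ :=
  ∑' j, ENNReal.ofReal ((w j)⁻¹ * (inner ℝ (φ j) h) ^ 2)

/-- The ellipsoid `Φ_w^r = {h ∈ Φ : ‖h‖_w² ≤ r²}`. -/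
def ellipsoid (w : ℕ+ → ℝ) (φ : ℕ+ → L2I) (r : ℝ) : Set L2I :=
  {h | h ∈ spanClosure φ ∧ wnormSq w φ h ≤ ENNReal.ofReal (r ^ 2)}

/-- The class `F_w^r` of all `f ∈ L²[0,1]` whose orthogonal projection on `Φ` lies in `Φ_w^r`. -/
def funClass (w : ℕ+ → ℝ) (φ : ℕ+ → L2I) (r : ℝ) : Set L2I :=
  {f | (spanClosure φ).starProjection f ∈ ellipsoid w φ r}

/-! ### Oracle dimension and rate -/

/-- `R_n^m = max (w_m, m / n)`. -/
def rate (w : ℕ+ → ℝ) (n : ℕ) (m : ℕ+) : ℝ := max (w m) ((m : ℕ) / (n : ℝ))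

theorem exists_minimizer (w : ℕ+ → ℝ) {n : ℕ} (hn : 1 ≤ n) :
    ∃ m, ∀ k, rate w n m ≤ rate w n k := by
  have hn' : (0 : ℝ) < n := by exact_mod_cast hn
  obtain ⟨M, hM⟩ := exists_nat_gt (rate w n 1 * n)
  obtain ⟨m, hm, hmin⟩ := Finset.exists_min_image (Finset.Icc (1 : ℕ+) (M.succPNat)) (rate w n)
    ⟨1, by simp⟩
  refine ⟨m, fun k => ?_⟩
  by_cases hk : k ≤ M.succPNat
  · exact hmin k (by simpa using hk)
  · have h1 : rate w n m ≤ rate w n 1 := hmin 1 (by simp)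
    have h2 : (M : ℝ) ≤ (k : ℕ) := by
      have h3 : M.succPNat < k := lt_of_not_ge hk
      have h4 : M + 1 < (k : ℕ) := by exact_mod_cast h3
      exact_mod_cast (by omega : M ≤ (k : ℕ))
    have h5 : rate w n 1 ≤ (k : ℕ) / (n : ℝ) := by
      rw [le_div_iff₀ hn']; linarith
    exact h1.trans (h5.trans (le_max_right _ _))

open Classical in
/-- The oracle dimension `m_n*`: the smallest minimizer of `m ↦ max (w_m, m / n)` over `m ≥ 1`
(a minimizer exists for every `n ≥ 1`). -/
def oracleDim (w : ℕ+ → ℝ) (n : ℕ) : ℕ+ :=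
  if h : ∃ m, ∀ k, rate w n m ≤ rate w n k then PNat.find h else 1

/-- The oracle rate `δ_n* = min_{m ≥ 1} max (w_m, m / n)`. -/
def oracleRate (w : ℕ+ → ℝ) (n : ℕ) : ℝ := rate w n (oracleDim w n)

theorem oracleDim_isLeast (w : ℕ+ → ℝ) {n : ℕ} (hn : 1 ≤ n) :
    IsLeast {m | ∀ k, rate w n m ≤ rate w n k} (oracleDim w n) := by
  classical
  have h := exists_minimizer w hn
  rw [oracleDim, dif_pos h]
  exact ⟨PNat.find_spec h, fun m hm => PNat.find_min' h hm⟩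

/-! ### Processes, mixing coefficients -/

section Mixing

variable {Ω : Type*} [MeasurableSpace Ω]

/-- A finite partition of `Ω` into sets of the `σ`-algebra `m`. -/
def IsFinPartition (m : MeasurableSpace Ω) {p : ℕ} (B : Fin p → Set Ω) : Prop :=
  (∀ i, MeasurableSet[m] (B i)) ∧ (Pairwise fun i j => Disjoint (B i) (B j)) ∧
    (⋃ i, B i) = Set.univ

/-- The absolutely regular (`β`-)mixing coefficient of two `σ`-algebras,
`½ sup ∑_i ∑_j |P(B_i) P(C_j) - P(B_i ∩ C_j)|` over all pairs of finite partitions. -/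
def betaMixing (P : Measure Ω) (m₁ m₂ : MeasurableSpace Ω) : ℝ≥0∞ :=
  2⁻¹ * ⨆ (p : ℕ) (q : ℕ) (B : Fin p → Set Ω) (C : Fin q → Set Ω)
    (_ : IsFinPartition m₁ B) (_ : IsFinPartition m₂ C),
    ∑ i, ∑ j, ENNReal.ofReal |P.real (B i) * P.real (C j) - P.real (B i ∩ C j)|

/-- The mixing coefficient `β(X, Y) = β(σ(X), σ(Y))` of two real random variables. -/
def betaRV (P : Measure Ω) (X Y : Ω → ℝ) : ℝ≥0∞ :=
  betaMixing P (MeasurableSpace.comap X inferInstance) (MeasurableSpace.comap Y inferInstance)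

/-- Strict stationarity: the finite dimensional distributions do not change under time shifts. -/
def StrictlyStationary (P : Measure Ω) (U : ℤ → Ω → ℝ) : Prop :=
  ∀ (s : Finset ℤ) (l : ℤ),
    P.map (fun ω (k : s) => U (k + l) ω) = P.map (fun ω (k : s) => U k ω)

/-- Each `(U_0, U_k)`, `k ≥ 1`, has a square integrable density `g_k` on `[0,1]²`, and
`sup_{k ≥ 1} ‖g_k - 1‖_{L²([0,1]²)} ≤ G`. -/
def CondD2 (P : Measure Ω) (U : ℤ → Ω → ℝ) (G : ℝ≥0) : Prop :=
  ∃ g : ℕ+ → ℝ × ℝ → ℝ,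
    (∀ k, 0 ≤ g k ∧ MemLp (g k) 2 (unif.prod unif) ∧
      P.map (fun ω => (U 0 ω, U (k : ℕ) ω)) =
        (unif.prod unif).withDensity (fun z => ENNReal.ofReal (g k z))) ∧
    (⨆ k, eLpNorm (fun z => g k z - 1) 2 (unif.prod unif)) ≤ G

/-- Random design: `(U_i)_{i ∈ ℤ}` is strictly stationary with uniform marginals on `[0,1]`; the
errors `ε_i` are iid., centred, standardized, and independent of the process `U`. -/
structure IsRandomDesign (P : Measure Ω) (U : ℤ → Ω → ℝ) (ε : ℕ → Ω → ℝ) : Prop where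
  measurable_U : ∀ i, Measurable (U i)
  stationary : StrictlyStationary P U
  uniform : ∀ i, P.map (U i) = unif
  measurable_noise : ∀ i, Measurable (ε i)
  indep_noise : iIndepFun ε P
  identDistrib_noise : ∀ i j, IdentDistrib (ε i) (ε j) P P
  memLp_noise : ∀ i, MemLp (ε i) 2 P
  mean_noise : ∀ i, ∫ ω, ε i ω ∂P = 0
  variance_noise : ∀ i, ∫ ω, ε i ω ^ 2 ∂P = 1
  indep_design_noise : IndepFun (fun ω i => U i ω) (fun ω i => ε i ω) P

end Mixing

/-! ### The estimator and its risk -/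

/-- The empirical coefficient `n⁻¹ ∑_{i=1}^n y_i φ_j(u_i)` of a sample `(y_i, u_i)_{i=1}^n`. -/
def coefEst (φ : ℕ+ → L2I) (n : ℕ) (y u : ℕ → ℝ) (j : ℕ+) : ℝ :=
  (n : ℝ)⁻¹ * ∑ i ∈ Finset.Icc 1 n, y i * φ j (u i)

/-- The orthogonal series estimator of dimension `m`. -/
def seriesEst (φ : ℕ+ → L2I) (n : ℕ) (m : ℕ+) (y u : ℕ → ℝ) : L2I :=
  ∑ j ∈ Finset.Icc 1 m, coefEst φ n y u j • φ j

section Risk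

variable {Ω : Type*} [MeasurableSpace Ω]

/-- The mean integrated squared error `E ‖f̂_m - f‖²` of the series estimator of dimension `m`
computed from the sample `(Y_i, U_i)_{i=1}^n` with `Y_i = f(U_i) + σ ε_i`. -/
def risk (P : Measure Ω) (U : ℤ → Ω → ℝ) (ε : ℕ → Ω → ℝ) (σ : ℝ) (φ : ℕ+ → L2I)
    (n : ℕ) (m : ℕ+) (f : L2I) : ℝ≥0∞ :=
  ∫⁻ ω, ‖seriesEst φ n m (fun i => f (U i ω) + σ * ε i ω) (fun i => U i ω) - f‖ₑ ^ 2 ∂P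

/-- The maximal risk of the series estimator over a class `F` of regression functions. -/
def maxRisk (P : Measure Ω) (U : ℤ → Ω → ℝ) (ε : ℕ → Ω → ℝ) (σ : ℝ) (φ : ℕ+ → L2I)
    (n : ℕ) (m : ℕ+) (F : Set L2I) : ℝ≥0∞ :=
  ⨆ f ∈ F, risk P U ε σ φ n m f

end Risk

end DepReg

end

open DepReg

/-! The risk splits into squared bias and variance. On the ellipsoid the squared bias is at most `w
m * r ^ 2`. The variance is `1 / n` times a double sum over the sample. Its diagonal is at most `m *
σ ^ 2 + τ ^ 2 * m * r ^ 2`, so it remains to show that twice the sum over lags of the absolute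
covariances is at most `τ ^ 2 * m` once `m` is large.

The covariances at lag `k`, summed over `j ≤ m`, equal the integral of `f(x) f(y) K(x,y) (g(x,y) -
1)`, with `K` the projection kernel and `g` the density of `(U_0, U_k)` (`covSum_eq`). Since `|f| ≤
R = r * A` almost everywhere (`ae_abs_le_of_mem_ellipsoid`), there are two bounds. Taking `|K| ≤ τ ^
2 * m` and the `L¹` norm of `g - 1`, which is at most `4 β`, gives a bound of order `m` that is
summable in the lag (`abs_covSum_le_betaRV`). Using that `K` has `L²` norm `√m` gives a bound of
order only `√m`, but with no decay in the lag (`abs_covSum_le_sqrt`).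

Outside a finite set `F` of lags the coefficients have a small sum, so the first bound suffices
there. On `F` the second bound is negligible against `m` when `m` is large. The oracle dimension
tends to infinity because the weights are positive (`eventually_le_oracleDim`). Both `F` and the
threshold for `m` use only the mixing coefficients, `R` and `G`; the weights enter when the
threshold for `m` is turned into one for `n`. -/

namespace DepReg

/-! ### Mixing coefficients and the `L¹` distance from independence -/

/-- The subsets of the plane that are unions of cells of a finite measurable grid. -/
def gridSets : Set (Set (ℝ × ℝ)) :=
  {S | ∃ (p q : ℕ) (a : ℝ → Fin p) (c : ℝ → Fin q) (T : Set (Fin p × Fin q)),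
    Measurable a ∧ Measurable c ∧ S = {z | (a z.1, c z.2) ∈ T}}

theorem isSetAlgebra_gridSets : IsSetAlgebra gridSets where
  empty_mem := ⟨1, 1, fun _ => 0, fun _ => 0, ∅, measurable_const, measurable_const, by simp⟩
  compl_mem := by
    rintro _ ⟨p, q, a, c, T, ha, hc, rfl⟩
    exact ⟨p, q, a, c, Tᶜ, ha, hc, rfl⟩
  union_mem := by
    rintro _ _ ⟨p, q, a, c, T, ha, hc, rfl⟩ ⟨p', q', a', c', T', ha', hc', rfl⟩
    -- Both sets are unions of cells of the common refinement, obtained by pairing the labels.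
    refine ⟨p * p', q * q', fun x => finProdFinEquiv (a x, a' x),
      fun y => finProdFinEquiv (c y, c' y),
      {v | ((finProdFinEquiv.symm v.1).1, (finProdFinEquiv.symm v.2).1) ∈ T ∨
        ((finProdFinEquiv.symm v.1).2, (finProdFinEquiv.symm v.2).2) ∈ T'},
      (measurable_of_finite _).comp (ha.prodMk ha'), (measurable_of_finite _).comp (hc.prodMk hc'),
      ?_⟩
    ext z
    simp only [Set.mem_union, Set.mem_ofPred_eq, Equiv.symm_apply_apply]

theorem measurableSet_of_mem_gridSets {S : Set (ℝ × ℝ)} (hS : S ∈ gridSets) :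
    MeasurableSet S := by
  obtain ⟨p, q, a, c, T, ha, hc, rfl⟩ := hS
  exact ((ha.comp measurable_fst).prodMk (hc.comp measurable_snd)) (T.toFinite.measurableSet)

theorem generateFrom_gridSets :
    (inferInstance : MeasurableSpace (ℝ × ℝ)) = MeasurableSpace.generateFrom gridSets := by
  classical
  apply le_antisymm
  · rw [show (inferInstance : MeasurableSpace (ℝ × ℝ)) = _ from generateFrom_prod.symm]
    apply MeasurableSpace.generateFrom_mono
    rintro _ ⟨B, hB, C, hC, rfl⟩
    refine ⟨2, 2, fun x => if x ∈ B then 1 else 0, fun y => if y ∈ C then 1 else 0, {(1, 1)},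
      Measurable.ite hB measurable_const measurable_const,
      Measurable.ite hC measurable_const measurable_const, ?_⟩
    ext z
    by_cases h1 : z.1 ∈ B <;> by_cases h2 : z.2 ∈ C <;> simp [h1, h2]
  · exact MeasurableSpace.generateFrom_le fun S hS => measurableSet_of_mem_gridSets hS

section

variable {Ω : Type*}

theorem isFinPartition_preimage {X : Ω → ℝ} {p : ℕ} {a : ℝ → Fin p}
    (ha : Measurable a) :
    IsFinPartition (MeasurableSpace.comap X inferInstance) fun i => X ⁻¹' (a ⁻¹' {i}) := by
  refine ⟨fun i => ⟨_, ha (measurableSet_singleton i), rfl⟩, fun i j hij => ?_, ?_⟩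
  · refine Set.disjoint_left.2 fun ω h1 h2 => hij ?_
    simp only [Set.mem_preimage, Set.mem_singleton_iff] at h1 h2
    exact h1.symm.trans h2
  · ext ω
    simp

variable [MeasurableSpace Ω]

theorem sum_le_two_mul_betaRV (P : Measure Ω) (X Y : Ω → ℝ) {p q : ℕ} {a : ℝ → Fin p}
    {c : ℝ → Fin q} (ha : Measurable a) (hc : Measurable c) :
    ∑ i, ∑ j, ENNReal.ofReal |P.real (X ⁻¹' (a ⁻¹' {i})) * P.real (Y ⁻¹' (c ⁻¹' {j}))
      - P.real (X ⁻¹' (a ⁻¹' {i}) ∩ Y ⁻¹' (c ⁻¹' {j}))| ≤ 2 * betaRV P X Y := by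
  rw [betaRV, betaMixing, ← mul_assoc, ENNReal.mul_inv_cancel (by simp) (by simp), one_mul]
  refine le_iSup_of_le p (le_iSup_of_le q (le_iSup_of_le (fun i => X ⁻¹' (a ⁻¹' {i}))
    (le_iSup_of_le (fun j => Y ⁻¹' (c ⁻¹' {j})) (le_iSup_of_le (isFinPartition_preimage ha)
      (le_iSup_of_le (isFinPartition_preimage hc) le_rfl)))))

/-- The density `h` of the difference between the law of `(X, Y)` and the product of the
marginal laws. -/
def IsDependenceDensity (P : Measure Ω) (X Y : Ω → ℝ) (μ : Measure (ℝ × ℝ)) (h : ℝ × ℝ → ℝ) :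
    Prop :=
  ∀ B C : Set ℝ, MeasurableSet B → MeasurableSet C →
    ∫ z in B ×ˢ C, h z ∂μ = P.real (X ⁻¹' B ∩ Y ⁻¹' C) - P.real (X ⁻¹' B) * P.real (Y ⁻¹' C)

variable {P : Measure Ω} {X Y : Ω → ℝ} {μ : Measure (ℝ × ℝ)} {h : ℝ × ℝ → ℝ}

/-- A grid set is a disjoint union of product cells, and the absolute cell integrals, summed over
the whole grid, form one of the sums in the supremum defining `β`. -/
theorem IsDependenceDensity.abs_setIntegral_le_of_mem_gridSets
    (hd : IsDependenceDensity P X Y μ h) (hh : Integrable h μ) {T : Set (ℝ × ℝ)}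
    (hT : T ∈ gridSets) :
    ENNReal.ofReal |∫ z in T, h z ∂μ| ≤ 2 * betaRV P X Y := by
  classical
  obtain ⟨p, q, a, c, T, ha, hc, rfl⟩ := hT
  have hcell : {z : ℝ × ℝ | (a z.1, c z.2) ∈ T} =
      ⋃ v ∈ T.toFinset, (a ⁻¹' {v.1}) ×ˢ (c ⁻¹' {v.2}) := by
    ext z
    simp
  rw [hcell, integral_biUnion_finset _
    (fun v _ => (ha (measurableSet_singleton _)).prod (hc (measurableSet_singleton _)))
    (fun v _ v' _ hv => by
      refine Set.disjoint_left.2 fun z h1 h2 => hv ?_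
      simp only [Set.mem_prod, Set.mem_preimage, Set.mem_singleton_iff] at h1 h2
      exact Prod.ext (h1.1.symm.trans h2.1) (h1.2.symm.trans h2.2))
    (fun v _ => hh.integrableOn)]
  have habs : ∀ v : Fin p × Fin q, ENNReal.ofReal |∫ z in (a ⁻¹' {v.1}) ×ˢ (c ⁻¹' {v.2}), h z ∂μ| =
      ENNReal.ofReal |P.real (X ⁻¹' (a ⁻¹' {v.1})) * P.real (Y ⁻¹' (c ⁻¹' {v.2}))
        - P.real (X ⁻¹' (a ⁻¹' {v.1}) ∩ Y ⁻¹' (c ⁻¹' {v.2}))| := fun v => by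
    rw [hd _ _ (ha (measurableSet_singleton _)) (hc (measurableSet_singleton _)), abs_sub_comm]
  have hsum := sum_le_two_mul_betaRV P X Y ha hc
  rw [← Fintype.sum_prod_type' (fun i j => ENNReal.ofReal
    |P.real (X ⁻¹' (a ⁻¹' {i})) * P.real (Y ⁻¹' (c ⁻¹' {j}))
      - P.real (X ⁻¹' (a ⁻¹' {i}) ∩ Y ⁻¹' (c ⁻¹' {j}))|)] at hsum
  refine le_trans ?_ hsum
  refine (ENNReal.ofReal_le_ofReal (Finset.abs_sum_le_sum_abs _ _)).trans ?_
  rw [ENNReal.ofReal_sum_of_nonneg fun _ _ => abs_nonneg _]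
  refine (Finset.sum_le_sum_of_subset (Finset.subset_univ _)).trans ?_
  exact Finset.sum_le_sum fun v _ => (habs v).le

theorem abs_setIntegral_sub_le (hh : Integrable h μ) {S T : Set (ℝ × ℝ)} (hS : MeasurableSet S)
    (hT : MeasurableSet T) :
    |(∫ z in S, h z ∂μ) - ∫ z in T, h z ∂μ| ≤ ∫ z in symmDiff S T, |h z| ∂μ := by
  rw [← integral_indicator hS, ← integral_indicator hT,
    ← integral_sub (hh.indicator hS) (hh.indicator hT), ← integral_indicator (hS.symmDiff hT)]
  refine (abs_integral_le_integral_abs).trans_eq (integral_congr_ae (ae_of_all _ fun z => ?_))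
  by_cases h1 : z ∈ S <;> by_cases h2 : z ∈ T <;> simp [h1, h2, Set.indicator, Set.mem_symmDiff]

/-- Grid sets form an algebra generating the Borel sets, hence are dense for the finite measure `|h|
μ`. Approximating in that measure, rather than in `μ`, directly controls the change in the integral
of `h`. -/
theorem IsDependenceDensity.abs_setIntegral_le (hd : IsDependenceDensity P X Y μ h)
    (hh : Integrable h μ) (hβ : betaRV P X Y ≠ ∞) {S : Set (ℝ × ℝ)} (hS : MeasurableSet S) :
    |∫ z in S, h z ∂μ| ≤ 2 * (betaRV P X Y).toReal := by
  have hfin : IsFiniteMeasure (μ.withDensity fun z => ‖h z‖ₑ) := isFiniteMeasure_withDensity hh.2.ne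
  refine le_of_forall_pos_le_add fun ε hε => ?_
  obtain ⟨T, hT, hST⟩ := (Measure.MeasureDense.of_generateFrom_isSetAlgebra_finite
    (μ := μ.withDensity fun z => ‖h z‖ₑ) isSetAlgebra_gridSets generateFrom_gridSets).approx S hS
      (measure_ne_top _ _) ε hε
  have hTm := measurableSet_of_mem_gridSets hT
  rw [withDensity_apply _ (hS.symmDiff hTm)] at hST
  have h1 : ∫ z in symmDiff S T, |h z| ∂μ ≤ ε := by
    have := integral_norm_eq_lintegral_enorm (μ := μ.restrict (symmDiff S T)) (f := h)
      hh.aestronglyMeasurable.restrict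
    simp only [Real.norm_eq_abs] at this
    rw [this]
    exact ENNReal.toReal_le_of_le_ofReal hε.le hST.le
  have h2 : |∫ z in T, h z ∂μ| ≤ 2 * (betaRV P X Y).toReal := by
    have := ENNReal.toReal_mono (ENNReal.mul_ne_top (by simp) hβ)
      (hd.abs_setIntegral_le_of_mem_gridSets hh hT)
    rwa [ENNReal.toReal_ofReal (abs_nonneg _), ENNReal.toReal_mul, ENNReal.toReal_ofNat] at this
  have h3 := abs_setIntegral_sub_le hh hS hTm
  have h4 := abs_sub_abs_le_abs_sub (∫ z in S, h z ∂μ) (∫ z in T, h z ∂μ)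
  linarith

/-- The `L¹` distance of a joint density from independence is controlled by the `β`-mixing
coefficient. -/
theorem IsDependenceDensity.integral_abs_le (hd : IsDependenceDensity P X Y μ h)
    (hh : Integrable h μ) (hβ : betaRV P X Y ≠ ∞) :
    ∫ z, |h z| ∂μ ≤ 4 * (betaRV P X Y).toReal := by
  obtain ⟨h', hm, hae⟩ := hh.aestronglyMeasurable
  -- The integral of `|h|` is split by the sign of a measurable representative. Each half is at most
  -- `2 β`, whence the (not sharp) factor `4`.
  have hS : MeasurableSet {z | 0 ≤ h' z} := measurableSet_le measurable_const hm.measurable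
  rw [← integral_add_compl hS hh.abs]
  have h1 : ∫ z in {z | 0 ≤ h' z}, |h z| ∂μ = ∫ z in {z | 0 ≤ h' z}, h z ∂μ := by
    refine setIntegral_congr_ae hS ?_
    filter_upwards [hae] with z hz hz'
    rw [hz]; exact abs_of_nonneg hz'
  have h2 : ∫ z in {z | 0 ≤ h' z}ᶜ, |h z| ∂μ = - ∫ z in {z | 0 ≤ h' z}ᶜ, h z ∂μ := by
    rw [← integral_neg]
    refine setIntegral_congr_ae hS.compl ?_
    filter_upwards [hae] with z hz hz'
    rw [hz]; exact abs_of_neg (not_le.1 hz')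
  rw [h1, h2]
  have h3 := le_abs_self (∫ z in {z | 0 ≤ h' z}, h z ∂μ)
  have h4 := neg_le_abs (∫ z in {z | 0 ≤ h' z}ᶜ, h z ∂μ)
  have h5 := hd.abs_setIntegral_le hh hβ hS
  have h6 := hd.abs_setIntegral_le hh hβ hS.compl
  linarith

end

/-! ### Expansions in an orthonormal system -/

section Hilbert

variable {E ι : Type*} [NormedAddCommGroup E] [InnerProductSpace ℝ E] {v : ι → E}

theorem norm_sq_sum_smul (hv : Orthonormal ℝ v) (s : Finset ι) (c : ι → ℝ) :
    ‖∑ j ∈ s, c j • v j‖ ^ 2 = ∑ j ∈ s, c j ^ 2 := by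
  rw [← real_inner_self_eq_norm_sq, hv.inner_sum]
  simp [sq]

theorem norm_sq_sum_smul_sub (hv : Orthonormal ℝ v) (s : Finset ι) (c : ι → ℝ) (f : E) :
    ‖∑ j ∈ s, c j • v j - f‖ ^ 2 =
      ∑ j ∈ s, (c j - inner ℝ (v j) f) ^ 2 + ‖f - ∑ j ∈ s, inner ℝ (v j) f • v j‖ ^ 2 := by
  -- The expansion for arbitrary coefficients is used twice: for `c`, and for the Fourier
  -- coefficients, which give the projection error.
  have key : ∀ d : ι → ℝ, ‖∑ j ∈ s, d j • v j - f‖ ^ 2 =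
      ∑ j ∈ s, d j ^ 2 - 2 * ∑ j ∈ s, d j * inner ℝ (v j) f + ‖f‖ ^ 2 := fun d => by
    rw [norm_sub_sq_real, norm_sq_sum_smul hv, sum_inner]
    simp [inner_smul_left]
  rw [key, ← norm_sub_rev, key]
  have : ∑ j ∈ s, (c j - inner ℝ (v j) f) ^ 2 = ∑ j ∈ s, c j ^ 2
      - 2 * ∑ j ∈ s, c j * inner ℝ (v j) f + ∑ j ∈ s, inner ℝ (v j) f ^ 2 := by
    rw [Finset.mul_sum, ← Finset.sum_sub_distrib, ← Finset.sum_add_distrib]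
    exact Finset.sum_congr rfl fun j _ => by ring
  rw [this]
  have : ∑ j ∈ s, inner ℝ (v j) f * inner ℝ (v j) f = ∑ j ∈ s, inner ℝ (v j) f ^ 2 :=
    Finset.sum_congr rfl fun j _ => by ring
  rw [this]
  ring

/-- The series converges by Bessel's inequality to some `g` in the closed span. Then `f - g` lies in
this span and is orthogonal to every `v j`, so it vanishes. -/
theorem hasSum_inner_smul [CompleteSpace E] (hv : Orthonormal ℝ v) {f : E}
    (hf : f ∈ (Submodule.span ℝ (Set.range v)).topologicalClosure) :
    HasSum (fun j => inner ℝ (v j) f • v j) f := by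
  set K := (Submodule.span ℝ (Set.range v)).topologicalClosure with hK
  have hmem : ∀ j, v j ∈ K := fun j =>
    Submodule.le_topologicalClosure _ (Submodule.subset_span ⟨j, rfl⟩)
  have hs : Summable (fun j => inner ℝ (v j) f • v j) := by
    have := (OrthogonalFamily.summable_iff_norm_sq_summable hv.orthogonalFamily
      (fun j => (inner ℝ (v j) f : ℝ))).2 (hv.inner_products_summable f)
    simpa using this
  obtain ⟨g, hg⟩ := hs
  have hgK : g ∈ K := by
    refine (Submodule.isClosed_topologicalClosure _).mem_of_tendsto hg (.of_forall fun s => ?_)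
    exact K.sum_mem fun j _ => K.smul_mem _ (hmem j)
  have hperp : ∀ j, inner ℝ (v j) (f - g) = 0 := fun j => by
    classical
    have h1 := hg.mapL (innerSL ℝ (v j))
    have h2 : HasSum (fun i => innerSL ℝ (v j) (inner ℝ (v i) f • v i)) (inner ℝ (v j) f) := by
      convert hasSum_ite_eq j (inner ℝ (v j) f : ℝ) using 2 with i
      simp only [innerSL_apply_apply, inner_smul_right, orthonormal_iff_ite.1 hv]
      by_cases h : i = j
      · subst h; simp
      · simp [h, Ne.symm h]
    rw [inner_sub_right, sub_eq_zero]
    exact h2.unique h1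
  have hzero : inner ℝ (f - g) (f - g) = (0 : ℝ) := by
    have hle : K ≤ (ℝ ∙ (f - g))ᗮ := by
      refine Submodule.topologicalClosure_minimal _ (Submodule.span_le.2 ?_)
        (Submodule.isClosed_orthogonal _)
      rintro _ ⟨j, rfl⟩
      rw [SetLike.mem_coe, Submodule.mem_orthogonal_singleton_iff_inner_left]
      exact hperp j
    exact Submodule.mem_orthogonal_singleton_iff_inner_left.1 (hle (K.sub_mem hf hgK))
  rw [inner_self_eq_zero, sub_eq_zero] at hzero
  rw [← hzero] at hg
  exact hg

/-- Outside `t` one has `1 ≤ c / w j`, so the remaining squared coefficients are dominated by `c`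
times the weighted ones. Empty `t` with `c = 1` bounds the norm; an initial segment with `c = w m`
bounds the bias. -/
theorem norm_sub_sum_sq_le (hv : Orthonormal ℝ v) {f : E}
    (hf : HasSum (fun j => inner ℝ (v j) f • v j) f) {w : ι → ℝ} (hw : ∀ j, 0 < w j) {q c : ℝ}
    (hq : ∀ s : Finset ι, ∑ j ∈ s, (w j)⁻¹ * inner ℝ (v j) f ^ 2 ≤ q) (hc : 0 ≤ c)
    (t : Finset ι) (ht : ∀ j, j ∉ t → w j ≤ c) :
    ‖f - ∑ j ∈ t, inner ℝ (v j) f • v j‖ ^ 2 ≤ c * q := by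
  classical
  refine le_of_tendsto ((hf.sub_const (∑ j ∈ t, inner ℝ (v j) f • v j)).norm.pow 2) ?_
  filter_upwards [eventually_ge_atTop t] with s hs
  rw [← Finset.sum_sdiff hs, add_sub_cancel_right, norm_sq_sum_smul hv]
  calc ∑ j ∈ s \ t, inner ℝ (v j) f ^ 2
      ≤ ∑ j ∈ s \ t, c * ((w j)⁻¹ * inner ℝ (v j) f ^ 2) := by
        refine Finset.sum_le_sum fun j hj => ?_
        rw [← mul_assoc]
        refine le_mul_of_one_le_left (sq_nonneg _) ?_
        rw [← div_eq_mul_inv, one_le_div (hw j)]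
        exact ht j (Finset.mem_sdiff.1 hj).2
    _ ≤ c * q := by
        rw [← Finset.mul_sum]
        exact mul_le_mul_of_nonneg_left (hq _) hc

end Hilbert

/-! ### Bounds on the ellipsoid, and growth of the oracle dimension -/

section FunctionClass

variable {w : ℕ+ → ℝ} {φ : ℕ+ → L2I} {r A τ : ℝ} {f : L2I}

theorem CondA1.ae_sum_sq_le (h : CondA1 φ τ) (m : ℕ+) :
    ∀ᵐ x ∂unif, ∑ j ∈ Finset.Icc 1 m, φ j x ^ 2 ≤ τ ^ 2 * (m : ℕ) := by
  filter_upwards [ae_le_essSup (μ := unif)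
    (f := fun x => ∑ j ∈ Finset.Icc 1 m, ENNReal.ofReal (φ j x ^ 2))] with x hx
  have h1 := hx.trans (h m)
  rwa [← ENNReal.ofReal_sum_of_nonneg (fun _ _ => sq_nonneg _),
    ENNReal.ofReal_le_ofReal_iff (by positivity)] at h1

theorem CondA2.ae_sum_sq_le (h : CondA2 w φ A) (hw : ∀ j, 0 < w j) :
    ∀ᵐ x ∂unif, ∀ s : Finset ℕ+, ∑ j ∈ s, w j * φ j x ^ 2 ≤ A ^ 2 := by
  filter_upwards [ae_le_essSup (μ := unif)
    (f := fun x => ∑' j, ENNReal.ofReal (w j * φ j x ^ 2))] with x hx s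
  have h1 := (ENNReal.sum_le_tsum s).trans (hx.trans h.bound)
  rwa [← ENNReal.ofReal_sum_of_nonneg (fun j _ => mul_nonneg (hw j).le (sq_nonneg _)),
    ENNReal.ofReal_le_ofReal_iff (by positivity)] at h1

theorem mem_ellipsoid_of_mem (hf : f ∈ funClass w φ r ∩ spanClosure φ) : f ∈ ellipsoid w φ r := by
  have h := hf.1
  rwa [funClass, Set.mem_ofPred_eq, Submodule.starProjection_eq_self_iff.2 hf.2] at h

theorem sum_le_of_mem_ellipsoid (hw : ∀ j, 0 < w j) (hf : f ∈ ellipsoid w φ r) (s : Finset ℕ+) :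
    ∑ j ∈ s, (w j)⁻¹ * inner ℝ (φ j) f ^ 2 ≤ r ^ 2 := by
  have h1 := (ENNReal.sum_le_tsum s).trans hf.2
  rwa [← ENNReal.ofReal_sum_of_nonneg
      (fun j _ => mul_nonneg (inv_nonneg.2 (hw j).le) (sq_nonneg _)),
    ENNReal.ofReal_le_ofReal_iff (by positivity)] at h1

theorem norm_sq_le_of_mem_ellipsoid (hφ : Orthonormal ℝ φ) (hw : ∀ j, 0 < w j)
    (hw1 : ∀ j, w j ≤ 1) (hf : f ∈ ellipsoid w φ r) : ‖f‖ ^ 2 ≤ r ^ 2 := by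
  simpa using norm_sub_sum_sq_le hφ (hasSum_inner_smul hφ hf.1) hw
    (sum_le_of_mem_ellipsoid hw hf) zero_le_one ∅ fun j _ => hw1 j

theorem bias_sq_le_of_mem_ellipsoid (hφ : Orthonormal ℝ φ) (hw : ∀ j, 0 < w j)
    (hanti : Antitone w) (hf : f ∈ ellipsoid w φ r) (m : ℕ+) :
    ‖f - ∑ j ∈ Finset.Icc 1 m, (inner ℝ (φ j) f : ℝ) • φ j‖ ^ 2 ≤ w m * r ^ 2 := by
  refine norm_sub_sum_sq_le hφ (hasSum_inner_smul hφ hf.1) hw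
    (sum_le_of_mem_ellipsoid hw hf) (hw m).le _ fun j hj => hanti ?_
  simp only [Finset.mem_Icc, one_le, true_and, not_le] at hj
  exact hj.le

/-- By Cauchy–Schwarz with weights `(w j)⁻¹` and `w j`, every partial sum is bounded by `r * A`
almost everywhere. The bound passes to `f` along an almost everywhere convergent subsequence. -/
theorem ae_abs_le_of_mem_ellipsoid (hφ : Orthonormal ℝ φ) (hw : ∀ j, 0 < w j)
    (h2 : CondA2 w φ A) (hr : 0 ≤ r) (hA : 0 ≤ A) (hf : f ∈ ellipsoid w φ r) :
    ∀ᵐ x ∂unif, |f x| ≤ r * A := by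
  have hlim : Tendsto (fun n : ℕ => ∑ j ∈ Finset.Icc 1 n.succPNat, (inner ℝ (φ j) f : ℝ) • φ j)
      atTop (𝓝 f) := by
    refine (hasSum_inner_smul hφ hf.1).comp (tendsto_atTop_finset_of_monotone ?_ ?_)
    · intro a b hab
      exact Finset.Icc_subset_Icc_right (Nat.succPNat_mono hab)
    · intro j
      refine ⟨(j : ℕ), ?_⟩
      simp only [Finset.mem_Icc, one_le, true_and]
      rw [← PNat.coe_le_coe, Nat.succPNat_coe]
      exact Nat.le_succ _
  obtain ⟨ns, -, hns⟩ := (tendstoInMeasure_of_tendsto_Lp hlim).exists_seq_tendsto_ae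
  have hcoe : ∀ᵐ x ∂unif, ∀ n : ℕ,
      (∑ j ∈ Finset.Icc 1 n.succPNat, (inner ℝ (φ j) f : ℝ) • φ j : L2I) x =
        ∑ j ∈ Finset.Icc 1 n.succPNat, inner ℝ (φ j) f * φ j x := by
    refine ae_all_iff.2 fun n => ?_
    have h3 : ∀ᵐ x ∂unif, ∀ j, ((inner ℝ (φ j) f : ℝ) • φ j : L2I) x = inner ℝ (φ j) f * φ j x :=
      ae_all_iff.2 fun j => by
        filter_upwards [Lp.coeFn_smul (inner ℝ (φ j) f : ℝ) (φ j)] with x hx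
        simpa using hx
    filter_upwards [h3, Lp.coeFn_finsetSum (Finset.Icc 1 n.succPNat)
      (fun j => (inner ℝ (φ j) f : ℝ) • φ j)] with x hx hx2
    rw [hx2, Finset.sum_apply]
    exact Finset.sum_congr rfl fun j _ => hx j
  filter_upwards [hns, hcoe, h2.ae_sum_sq_le hw] with x hx hx2 hx3
  refine le_of_tendsto hx.abs (.of_forall fun i => ?_)
  rw [hx2]
  refine abs_le_of_sq_le_sq ?_ (by positivity)
  rw [mul_pow]
  calc _ ≤ (∑ j ∈ Finset.Icc 1 (ns i).succPNat, (w j)⁻¹ * inner ℝ (φ j) f ^ 2) *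
        ∑ j ∈ Finset.Icc 1 (ns i).succPNat, w j * φ j x ^ 2 := by
        refine Finset.sum_sq_le_sum_mul_sum_of_sq_le_mul _
          (fun j _ => mul_nonneg (inv_nonneg.2 (hw j).le) (sq_nonneg _))
          (fun j _ => mul_nonneg (hw j).le (sq_nonneg _)) fun j _ => le_of_eq ?_
        have := (hw j).ne'
        field_simp
    _ ≤ r ^ 2 * A ^ 2 := mul_le_mul (sum_le_of_mem_ellipsoid hw hf _) (hx3 _)
        (Finset.sum_nonneg fun j _ => mul_nonneg (hw j).le (sq_nonneg _)) (sq_nonneg _)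

end FunctionClass

/-- A dimension below `M` has rate at least `w M > 0`, whereas a fixed `m` with `w m < w M` has rate
below `w M` as soon as `m / n < w M`. -/
theorem eventually_le_oracleDim {w : ℕ+ → ℝ} (hw : ∀ j, 0 < w j) (hanti : Antitone w)
    (hlim : Tendsto w atTop (𝓝 0)) (M : ℕ+) : ∀ᶠ n in atTop, M ≤ oracleDim w n := by
  obtain ⟨m, hm⟩ := (hlim.eventually_lt_const (hw M)).exists
  have h1 : ∀ᶠ n : ℕ in atTop, (m : ℕ) / (n : ℝ) < w M :=
    (tendsto_const_div_atTop_nhds_zero_nat _).eventually_lt_const (hw M)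
  filter_upwards [h1, eventually_ge_atTop 1] with n hn hn1
  have h2 := (oracleDim_isLeast w hn1).1 m
  by_contra hlt
  have h3 := hanti (not_le.1 hlt).le
  have h4 : rate w n m < w M := max_lt hm hn
  have h5 : w (oracleDim w n) ≤ rate w n (oracleDim w n) := le_max_left _ _
  linarith

/-! ### Integrals of basis functions and the projection kernel -/

theorem measurable_coeFn (f : L2I) : Measurable f := (Lp.stronglyMeasurable f).measurable

theorem integral_mul_eq_inner (f g : L2I) : ∫ x, f x * g x ∂unif = inner ℝ f g := by
  rw [L2.inner_def]
  exact integral_congr_ae (ae_of_all _ fun x => by simp [mul_comm])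

theorem integrable_coeFn_mul (f g : L2I) : Integrable (fun x => f x * g x) unif :=
  (Lp.memLp f).integrable_mul (Lp.memLp g)

theorem integral_mul_eq_ite {φ : ℕ+ → L2I} (hφ : Orthonormal ℝ φ) (j l : ℕ+) :
    ∫ x, φ j x * φ l x ∂unif = if j = l then 1 else 0 := by
  rw [integral_mul_eq_inner, orthonormal_iff_ite.1 hφ]

theorem ae_prod_unif {p : ℝ → Prop} (h : ∀ᵐ x ∂unif, p x) :
    ∀ᵐ z ∂(unif.prod unif), p z.1 ∧ p z.2 :=
  (Measure.quasiMeasurePreserving_fst.ae h).and (Measure.quasiMeasurePreserving_snd.ae h)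

section Kernel

variable (φ : ℕ+ → L2I) (m : ℕ+)

/-- The kernel of the orthogonal projection on the span of the first `m` functions. -/
noncomputable def projKernel (z : ℝ × ℝ) : ℝ := ∑ j ∈ Finset.Icc 1 m, φ j z.1 * φ j z.2

theorem projKernel_sq (z : ℝ × ℝ) : projKernel φ m z ^ 2 =
    ∑ j ∈ Finset.Icc 1 m, ∑ l ∈ Finset.Icc 1 m, (φ j z.1 * φ l z.1) * (φ j z.2 * φ l z.2) := by
  rw [projKernel, sq, Finset.sum_mul_sum]
  exact Finset.sum_congr rfl fun j _ => Finset.sum_congr rfl fun l _ => by ring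

theorem integrable_projKernel_sq : Integrable (fun z => projKernel φ m z ^ 2)
    (unif.prod unif) := by
  simp_rw [projKernel_sq]
  exact integrable_finsetSum _ fun j _ => integrable_finsetSum _ fun l _ =>
    (integrable_coeFn_mul (φ j) (φ l)).mul_prod (integrable_coeFn_mul (φ j) (φ l))

variable {φ}

/-- This is the squared Hilbert–Schmidt norm of a projection of rank `m`: only the diagonal terms `j
= l` survive. -/
theorem integral_projKernel_sq (hφ : Orthonormal ℝ φ) :
    ∫ z, projKernel φ m z ^ 2 ∂(unif.prod unif) = (m : ℕ) := by
  have hint : ∀ j l, Integrable (fun z : ℝ × ℝ => (φ j z.1 * φ l z.1) * (φ j z.2 * φ l z.2))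
      (unif.prod unif) := fun j l =>
    (integrable_coeFn_mul (φ j) (φ l)).mul_prod (integrable_coeFn_mul (φ j) (φ l))
  have hval : ∀ j l, ∫ z : ℝ × ℝ, (φ j z.1 * φ l z.1) * (φ j z.2 * φ l z.2) ∂(unif.prod unif) =
      if j = l then 1 else 0 := fun j l => by
    rw [integral_prod_mul (fun x => φ j x * φ l x) (fun x => φ j x * φ l x),
      integral_mul_eq_ite hφ]
    simp
  simp_rw [projKernel_sq]
  rw [integral_finsetSum _ fun j _ => integrable_finsetSum _ fun l _ => hint j l,
    Finset.sum_congr rfl fun j _ => integral_finsetSum _ fun l _ => hint j l]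
  simp_rw [hval]
  rw [Finset.sum_congr rfl fun j hj => (Finset.sum_ite_eq _ j _).trans (if_pos hj)]
  simp

theorem abs_projKernel_le {τ : ℝ} {x y : ℝ}
    (hx : ∑ j ∈ Finset.Icc 1 m, φ j x ^ 2 ≤ τ ^ 2 * (m : ℕ))
    (hy : ∑ j ∈ Finset.Icc 1 m, φ j y ^ 2 ≤ τ ^ 2 * (m : ℕ)) :
    |projKernel φ m (x, y)| ≤ τ ^ 2 * (m : ℕ) := by
  refine abs_le_of_sq_le_sq ?_ (by positivity)
  refine (Finset.sum_mul_sq_le_sq_mul_sq _ _ _).trans ?_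
  rw [sq (τ ^ 2 * _)]
  exact mul_le_mul hx hy (Finset.sum_nonneg fun j _ => sq_nonneg _) (by positivity)

end Kernel

/-! ### Covariances of a pair of uniform variables -/

section Pair

variable {Ω : Type*} [MeasurableSpace Ω]

/-- A pair of uniform variables with a square integrable density on the unit square. -/
structure IsUniformPair (P : Measure Ω) (X Y : Ω → ℝ) (g : ℝ × ℝ → ℝ) : Prop where
  measurable_left : Measurable X
  measurable_right : Measurable Y
  map_left : P.map X = unif
  map_right : P.map Y = unif
  nonneg : 0 ≤ g
  memLp : MemLp g 2 (unif.prod unif)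
  map_pair : P.map (fun ω => (X ω, Y ω)) =
    (unif.prod unif).withDensity (fun z => ENNReal.ofReal (g z))

variable {P : Measure Ω} {X Y : Ω → ℝ} {g : ℝ × ℝ → ℝ}

namespace IsUniformPair

theorem memLp_sub_one (h : IsUniformPair P X Y g) :
    MemLp (fun z => g z - 1) 2 (unif.prod unif) := h.memLp.sub (memLp_const 1)

theorem integrable (h : IsUniformPair P X Y g) : Integrable g (unif.prod unif) :=
  h.memLp.integrable one_le_two

theorem integrable_sub_one (h : IsUniformPair P X Y g) :
    Integrable (fun z => g z - 1) (unif.prod unif) := h.memLp_sub_one.integrable one_le_two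

/-- Both marginals are uniform, so the product of the marginal laws has density `1`. -/
theorem isDependenceDensity (h : IsUniformPair P X Y g) :
    IsDependenceDensity P X Y (unif.prod unif) (fun z => g z - 1) := by
  intro B C hB hC
  rw [integral_sub h.integrable.integrableOn (integrable_const _).integrableOn]
  congr 1
  · rw [measureReal_def, show X ⁻¹' B ∩ Y ⁻¹' C = (fun ω => (X ω, Y ω)) ⁻¹' (B ×ˢ C) from rfl,
      ← Measure.map_apply (h.measurable_left.prodMk h.measurable_right) (hB.prod hC), h.map_pair,
      withDensity_apply _ (hB.prod hC),
      integral_eq_lintegral_of_nonneg_ae (ae_of_all _ h.nonneg)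
        h.integrable.aestronglyMeasurable.restrict]
  · rw [measureReal_def, measureReal_def, ← Measure.map_apply h.measurable_left hB,
      ← Measure.map_apply h.measurable_right hC, h.map_left, h.map_right]
    simp [measureReal_def]

theorem integral_comp_eq (h : IsUniformPair P X Y g) {v : ℝ × ℝ → ℝ} (hv : Measurable v) :
    ∫ ω, v (X ω, Y ω) ∂P = ∫ z, v z * g z ∂(unif.prod unif) := by
  rw [← integral_map (f := v) (h.measurable_left.prodMk h.measurable_right).aemeasurable
    hv.aestronglyMeasurable, h.map_pair, integral_withDensity_eq_integral_toReal_smul₀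
      h.integrable.aestronglyMeasurable.aemeasurable.ennreal_ofReal (ae_of_all _ fun _ => by simp)]
  refine integral_congr_ae (ae_of_all _ fun z => ?_)
  simp [ENNReal.toReal_ofReal (h.nonneg z), mul_comm]

theorem integral_mul_comp_sub (h : IsUniformPair P X Y g) {u : ℝ → ℝ} (hu : Measurable u) {c : ℝ}
    (hc : ∀ᵐ x ∂unif, |u x| ≤ c) :
    ∫ ω, u (X ω) * u (Y ω) ∂P - (∫ x, u x ∂unif) ^ 2 =
      ∫ z, u z.1 * u z.2 * (g z - 1) ∂(unif.prod unif) := by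
  have hm : Measurable fun z : ℝ × ℝ => u z.1 * u z.2 :=
    (hu.comp measurable_fst).mul (hu.comp measurable_snd)
  have hb : ∀ᵐ z ∂(unif.prod unif), ‖u z.1 * u z.2‖ ≤ c * c := by
    filter_upwards [ae_prod_unif hc] with z hz
    rw [norm_mul]
    exact mul_le_mul hz.1 hz.2 (norm_nonneg _) ((abs_nonneg _).trans hz.1)
  rw [h.integral_comp_eq hm, sq, ← integral_prod_mul, ← integral_sub]
  · exact integral_congr_ae (ae_of_all _ fun z => by ring)
  · exact h.integrable.bdd_mul hm.aestronglyMeasurable hb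
  · exact Integrable.of_bound hm.aestronglyMeasurable _ hb

end IsUniformPair

/-- The sum of the covariances of `f φ_j (X)` and `f φ_j (Y)` over `j ≤ m`, for uniform
`X` and `Y`. -/
noncomputable def covSum (P : Measure Ω) (φ : ℕ+ → L2I) (f : L2I) (m : ℕ+) (X Y : Ω → ℝ) : ℝ :=
  ∑ j ∈ Finset.Icc 1 m, (∫ ω, f (X ω) * φ j (X ω) * (f (Y ω) * φ j (Y ω)) ∂P
    - inner ℝ (φ j) f ^ 2)

variable {φ : ℕ+ → L2I} {f : L2I} {m : ℕ+} {R τ : ℝ}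

theorem ae_abs_basis_le (h1 : CondA1 φ τ) :
    ∀ᵐ x ∂unif, ∀ j ∈ Finset.Icc 1 m, |φ j x| ≤ |τ| * √(m : ℕ) := by
  filter_upwards [h1.ae_sum_sq_le m] with x hx j hj
  refine abs_le_of_sq_le_sq ?_ (by positivity)
  rw [mul_pow, sq_abs, Real.sq_sqrt (by positivity)]
  exact (Finset.single_le_sum (f := fun j => φ j x ^ 2) (fun _ _ => sq_nonneg _) hj).trans hx

theorem ae_abs_mul_basis_le (h1 : CondA1 φ τ) (hf : ∀ᵐ x ∂unif, |f x| ≤ R) :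
    ∀ᵐ x ∂unif, ∀ j ∈ Finset.Icc 1 m, |f x * φ j x| ≤ R * (|τ| * √(m : ℕ)) := by
  filter_upwards [ae_abs_basis_le (m := m) h1, hf] with x hx hfx j hj
  rw [abs_mul]
  exact mul_le_mul hfx (hx j hj) (abs_nonneg _) ((abs_nonneg _).trans hfx)

theorem measurable_mul_basis (f : L2I) (φ : ℕ+ → L2I) (j : ℕ+) :
    Measurable fun x => f x * φ j x := (measurable_coeFn f).mul (measurable_coeFn (φ j))

/-- Summing over `j` before estimating assembles the projection kernel, whose `L²` norm is only
`√m`. -/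
theorem IsUniformPair.covSum_eq (h : IsUniformPair P X Y g) (h1 : CondA1 φ τ)
    (hf : ∀ᵐ x ∂unif, |f x| ≤ R) :
    covSum P φ f m X Y =
      ∫ z, f z.1 * f z.2 * projKernel φ m z * (g z - 1) ∂(unif.prod unif) := by
  have hb : ∀ j ∈ Finset.Icc 1 m, ∀ᵐ x ∂unif, |f x * φ j x| ≤ R * (|τ| * √(m : ℕ)) :=
    fun j hj => (ae_abs_mul_basis_le h1 hf).mono fun x hx => hx j hj
  have h3 : ∀ z, f z.1 * f z.2 * projKernel φ m z * (g z - 1) =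
      ∑ j ∈ Finset.Icc 1 m, f z.1 * φ j z.1 * (f z.2 * φ j z.2) * (g z - 1) := fun z => by
    rw [projKernel, Finset.mul_sum, Finset.sum_mul]
    exact Finset.sum_congr rfl fun j _ => by ring
  simp_rw [h3]
  rw [integral_finsetSum]
  · refine Finset.sum_congr rfl fun j hj => ?_
    rw [← h.integral_mul_comp_sub (measurable_mul_basis f φ j) (hb j hj), integral_mul_eq_inner,
      real_inner_comm]
  · intro j hj
    refine h.integrable_sub_one.bdd_mul (c := R * (|τ| * √(m : ℕ)) * (R * (|τ| * √(m : ℕ))))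
      (((measurable_mul_basis f φ j).comp measurable_fst).mul
        ((measurable_mul_basis f φ j).comp measurable_snd)).aestronglyMeasurable ?_
    filter_upwards [ae_prod_unif (hb j hj)] with z hz
    rw [norm_mul]
    exact mul_le_mul hz.1 hz.2 (norm_nonneg _) ((abs_nonneg _).trans hz.1)

/-- The bound on the covariances in terms of the mixing coefficient. -/
theorem IsUniformPair.abs_covSum_le_betaRV (h : IsUniformPair P X Y g) (h1 : CondA1 φ τ)
    (hf : ∀ᵐ x ∂unif, |f x| ≤ R) (hβ : betaRV P X Y ≠ ∞) :
    |covSum P φ f m X Y| ≤ R ^ 2 * (τ ^ 2 * (m : ℕ)) * (4 * (betaRV P X Y).toReal) := by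
  rw [h.covSum_eq h1 hf]
  refine le_trans ?_ (mul_le_mul_of_nonneg_left
    (h.isDependenceDensity.integral_abs_le h.integrable_sub_one hβ) (by positivity))
  rw [← integral_const_mul, ← Real.norm_eq_abs]
  refine norm_integral_le_of_norm_le (h.integrable_sub_one.abs.const_mul _) ?_
  filter_upwards [ae_prod_unif hf, ae_prod_unif (h1.ae_sum_sq_le m)] with z hz hz2
  rw [norm_mul, norm_mul, norm_mul, sq R]
  exact mul_le_mul_of_nonneg_right (mul_le_mul (mul_le_mul hz.1 hz.2 (norm_nonneg _)
    ((abs_nonneg _).trans hz.1)) (abs_projKernel_le m hz2.1 hz2.2) (norm_nonneg _)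
    (mul_self_nonneg _)) (norm_nonneg _)

theorem integral_sq_le_of_eLpNorm_le {α : Type*} [MeasurableSpace α] {μ : Measure α} {h : α → ℝ}
    (hh : MemLp h 2 μ) {G : ℝ≥0} (hG : eLpNorm h 2 μ ≤ G) : ∫ z, h z ^ 2 ∂μ ≤ (G : ℝ) ^ 2 := by
  have h1 := eLpNorm_nnreal_pow_eq_lintegral (f := h) (μ := μ) (p := 2) (by simp)
  have h2 : ∫ z, h z ^ 2 ∂μ = (∫⁻ z, ‖h z‖ₑ ^ ((2 : ℝ≥0) : ℝ) ∂μ).toReal := by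
    rw [integral_eq_lintegral_of_nonneg_ae (ae_of_all _ fun _ => sq_nonneg _)
      (hh.aestronglyMeasurable.pow 2)]
    congr 1
    refine lintegral_congr fun z => ?_
    rw [← sq_abs, ENNReal.ofReal_pow (abs_nonneg _), ← Real.enorm_eq_ofReal_abs]
    norm_num
  rw [h2, ← h1]
  refine ENNReal.toReal_le_of_le_ofReal (by positivity) ?_
  rw [ENNReal.ofReal_pow G.coe_nonneg, ENNReal.ofReal_coe_nnreal]
  norm_num
  exact pow_le_pow_left₀ zero_le hG 2

/-- The bound on the covariances in terms of the `L²` norm of the density. -/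
theorem IsUniformPair.abs_covSum_le_sqrt (h : IsUniformPair P X Y g) (hφ : Orthonormal ℝ φ)
    (h1 : CondA1 φ τ) (hf : ∀ᵐ x ∂unif, |f x| ≤ R) {G : ℝ≥0}
    (hG : eLpNorm (fun z => g z - 1) 2 (unif.prod unif) ≤ G) :
    |covSum P φ f m X Y| ≤ R ^ 2 * (1 + (G : ℝ) ^ 2) * √(m : ℕ) := by
  have hm : (0 : ℝ) < (m : ℕ) := by exact_mod_cast m.pos
  have hs : 0 < √(m : ℕ) := Real.sqrt_pos.2 hm
  have hint1 := (integrable_projKernel_sq φ m).const_mul (√(m : ℕ))⁻¹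
  have hint2 := h.memLp_sub_one.integrable_sq.const_mul √(m : ℕ)
  -- In place of Cauchy–Schwarz, the pointwise inequality `2ac ≤ s⁻¹a² + sc²` with `s = √m` is
  -- integrated. The choice of `s` balances the two integrals, `m` and at most `G ^ 2`; the factor
  -- `1/2` is given away.
  have key : ∫ z, R ^ 2 * ((√(m : ℕ))⁻¹ * projKernel φ m z ^ 2 + √(m : ℕ) * (g z - 1) ^ 2)
      ∂(unif.prod unif) ≤ R ^ 2 * (1 + (G : ℝ) ^ 2) * √(m : ℕ) := by
    rw [integral_const_mul, integral_add hint1 hint2, integral_const_mul, integral_const_mul,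
      integral_projKernel_sq m hφ, mul_assoc]
    refine mul_le_mul_of_nonneg_left ?_ (sq_nonneg _)
    have h3 : (√(m : ℕ))⁻¹ * ((m : ℕ) : ℝ) = √(m : ℕ) := by
      rw [inv_mul_eq_div, Real.div_sqrt]
    have h4 := mul_le_mul_of_nonneg_left (integral_sq_le_of_eLpNorm_le h.memLp_sub_one hG) hs.le
    rw [h3]
    linarith
  rw [h.covSum_eq h1 hf, ← Real.norm_eq_abs]
  refine (norm_integral_le_of_norm_le ((hint1.add hint2).const_mul (R ^ 2)) ?_).trans key
  filter_upwards [ae_prod_unif hf] with z hz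
  rw [norm_mul, norm_mul, norm_mul, sq R, mul_assoc]
  refine mul_le_mul (mul_le_mul hz.1 hz.2 (norm_nonneg _) ((abs_nonneg _).trans hz.1)) ?_
    (by positivity) (mul_self_nonneg _)
  rw [Real.norm_eq_abs, Real.norm_eq_abs, Pi.add_apply, ← sq_abs (projKernel φ m z), ← sq_abs (g z - 1)]
  set a := |projKernel φ m z|
  set c := |g z - 1|
  set s := √((m : ℕ) : ℝ)
  have ha : 0 ≤ a := abs_nonneg _
  have hc : 0 ≤ c := abs_nonneg _
  have h5 : s⁻¹ * a ^ 2 + s * c ^ 2 - 2 * (a * c) = s⁻¹ * (a - s * c) ^ 2 := by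
    field_simp; ring
  have h6 : 0 ≤ s⁻¹ * (a - s * c) ^ 2 := by positivity
  nlinarith [mul_nonneg ha hc]

end Pair

theorem integral_add_add {α : Type*} [MeasurableSpace α] {μ : Measure α} {f₁ f₂ f₃ f₄ : α → ℝ}
    (h₁ : Integrable f₁ μ) (h₂ : Integrable f₂ μ) (h₃ : Integrable f₃ μ) (h₄ : Integrable f₄ μ) :
    ∫ x, f₁ x + f₂ x + (f₃ x + f₄ x) ∂μ =
      ∫ x, f₁ x ∂μ + ∫ x, f₂ x ∂μ + (∫ x, f₃ x ∂μ + ∫ x, f₄ x ∂μ) := by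
  rw [← integral_add h₁ h₂, ← integral_add h₃ h₄]
  exact integral_add (h₁.add h₂) (h₃.add h₄)

/-! ### Moments under the random design -/

section

variable {Ω : Type*} [MeasurableSpace Ω] {P : Measure Ω} {U : ℤ → Ω → ℝ} {ε : ℕ → Ω → ℝ}

namespace IsRandomDesign

theorem integral_comp (h : IsRandomDesign P U ε) (i : ℤ) {u : ℝ → ℝ} (hu : Measurable u) :
    ∫ ω, u (U i ω) ∂P = ∫ x, u x ∂unif := by
  rw [← h.uniform i, integral_map (h.measurable_U i).aemeasurable hu.aestronglyMeasurable]

theorem ae_comp (h : IsRandomDesign P U ε) (i : ℤ) {p : ℝ → Prop} (hp : ∀ᵐ x ∂unif, p x) :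
    ∀ᵐ ω ∂P, p (U i ω) :=
  ae_of_ae_map (h.measurable_U i).aemeasurable (by rwa [h.uniform i])

theorem map_pair_shift (h : IsRandomDesign P U ε) (i k : ℤ) :
    P.map (fun ω => (U i ω, U (k + i) ω)) = P.map (fun ω => (U 0 ω, U k ω)) := by
  have hs := h.stationary {0, k} i
  have h0 : (0 : ℤ) ∈ ({0, k} : Finset ℤ) := by simp
  have hk : k ∈ ({0, k} : Finset ℤ) := by simp
  have hp : Measurable fun x : ({0, k} : Finset ℤ) → ℝ => (x ⟨0, h0⟩, x ⟨k, hk⟩) :=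
    (measurable_pi_apply _).prodMk (measurable_pi_apply _)
  have h2 := congrArg (Measure.map fun x : ({0, k} : Finset ℤ) → ℝ => (x ⟨0, h0⟩, x ⟨k, hk⟩)) hs
  rw [Measure.map_map hp (measurable_pi_lambda _ fun j => h.measurable_U _),
    Measure.map_map hp (measurable_pi_lambda _ fun j => h.measurable_U _)] at h2
  simpa [Function.comp_def] using h2

theorem covSum_shift (h : IsRandomDesign P U ε) (φ : ℕ+ → L2I) (f : L2I) (m : ℕ+) (i k : ℤ) :
    covSum P φ f m (U i) (U (k + i)) = covSum P φ f m (U 0) (U k) := by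
  refine Finset.sum_congr rfl fun j _ => ?_
  congr 1
  have hv : Measurable fun z : ℝ × ℝ => f z.1 * φ j z.1 * (f z.2 * φ j z.2) :=
    ((measurable_mul_basis f φ j).comp measurable_fst).mul
      ((measurable_mul_basis f φ j).comp measurable_snd)
  rw [← integral_map (f := fun z : ℝ × ℝ => f z.1 * φ j z.1 * (f z.2 * φ j z.2))
      (φ := fun ω => (U i ω, U (k + i) ω))
      ((h.measurable_U _).prodMk (h.measurable_U _)).aemeasurable hv.aestronglyMeasurable,
    h.map_pair_shift, integral_map ((h.measurable_U _).prodMk (h.measurable_U _)).aemeasurable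
      hv.aestronglyMeasurable]

theorem indepFun_comp (h : IsRandomDesign P U ε) {d : (ℤ → ℝ) → ℝ} (hd : Measurable d)
    {e : (ℕ → ℝ) → ℝ} (he : Measurable e) :
    IndepFun (fun ω => d fun i => U i ω) (fun ω => e fun i => ε i ω) P :=
  h.indep_design_noise.comp hd he

theorem measurable_comp_U (h : IsRandomDesign P U ε) {d : (ℤ → ℝ) → ℝ} (hd : Measurable d) :
    Measurable fun ω => d fun i => U i ω :=
  hd.comp (measurable_pi_lambda _ h.measurable_U)

theorem integrable_noise (h : IsRandomDesign P U ε) [IsProbabilityMeasure P] (i : ℕ) :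
    Integrable (ε i) P :=
  (h.memLp_noise i).integrable one_le_two

theorem integrable_mul_noise (h : IsRandomDesign P U ε) [IsProbabilityMeasure P]
    {d : (ℤ → ℝ) → ℝ} (hd : Measurable d)
    (hi : Integrable (fun ω => d fun i => U i ω) P) (l : ℕ) :
    Integrable (fun ω => d (fun i => U i ω) * ε l ω) P :=
  (h.indepFun_comp hd (measurable_pi_apply l)).integrable_mul hi (h.integrable_noise l)

theorem integral_mul_noise (h : IsRandomDesign P U ε) {d : (ℤ → ℝ) → ℝ} (hd : Measurable d)
    (l : ℕ) : ∫ ω, d (fun i => U i ω) * ε l ω ∂P = 0 := by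
  rw [(h.indepFun_comp hd (measurable_pi_apply l)).integral_fun_mul_eq_mul_integral
    (h.measurable_comp_U hd).aestronglyMeasurable (h.measurable_noise l).aestronglyMeasurable,
    h.mean_noise, mul_zero]

theorem integrable_noise_mul_noise (h : IsRandomDesign P U ε) (i l : ℕ) :
    Integrable (fun ω => ε i ω * ε l ω) P :=
  (h.memLp_noise i).integrable_mul (h.memLp_noise l)

theorem integral_noise_mul_noise (h : IsRandomDesign P U ε) (i l : ℕ) :
    ∫ ω, ε i ω * ε l ω ∂P = if i = l then 1 else 0 := by
  split_ifs with hil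
  · subst hil
    simp_rw [← sq]
    exact h.variance_noise i
  · rw [(h.indep_noise.indepFun hil).integral_fun_mul_eq_mul_integral
      (h.measurable_noise i).aestronglyMeasurable (h.measurable_noise l).aestronglyMeasurable,
      h.mean_noise, zero_mul]

theorem measurable_noise_pair (i l : ℕ) : Measurable fun e : ℕ → ℝ => e i * e l :=
  (measurable_pi_apply i).mul (measurable_pi_apply l)

theorem integrable_mul_noise_mul_noise (h : IsRandomDesign P U ε) {d : (ℤ → ℝ) → ℝ}
    (hd : Measurable d) (hi : Integrable (fun ω => d fun i => U i ω) P) (i l : ℕ) :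
    Integrable (fun ω => d (fun i => U i ω) * (ε i ω * ε l ω)) P :=
  (h.indepFun_comp hd (measurable_noise_pair i l)).integrable_mul hi
    (h.integrable_noise_mul_noise i l)

theorem integral_mul_noise_mul_noise (h : IsRandomDesign P U ε) {d : (ℤ → ℝ) → ℝ}
    (hd : Measurable d) (i l : ℕ) :
    ∫ ω, d (fun i => U i ω) * (ε i ω * ε l ω) ∂P =
      (∫ ω, d (fun i => U i ω) ∂P) * if i = l then 1 else 0 := by
  rw [(h.indepFun_comp hd (measurable_noise_pair i l)).integral_fun_mul_eq_mul_integral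
    (h.measurable_comp_U hd).aestronglyMeasurable
    ((h.measurable_noise i).mul (h.measurable_noise l)).aestronglyMeasurable,
    h.integral_noise_mul_noise]

variable [IsProbabilityMeasure P]

theorem integrable_mul_comp (h : IsRandomDesign P U ε) {u v : ℝ → ℝ} (hu : Measurable u)
    (hv : Measurable v) {c c' : ℝ} (hc : ∀ᵐ x ∂unif, |u x| ≤ c) (hc' : ∀ᵐ x ∂unif, |v x| ≤ c')
    (i l : ℤ) : Integrable (fun ω => u (U i ω) * v (U l ω)) P := by
  refine Integrable.of_bound ((hu.comp (h.measurable_U i)).mul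
    (hv.comp (h.measurable_U l))).aestronglyMeasurable (c * c') ?_
  filter_upwards [h.ae_comp i hc, h.ae_comp l hc'] with ω h1 h2
  rw [norm_mul]
  exact mul_le_mul h1 h2 (norm_nonneg _) ((abs_nonneg _).trans h1)

theorem integrable_comp (h : IsRandomDesign P U ε) {u : ℝ → ℝ} (hu : Measurable u)
    {c : ℝ} (hc : ∀ᵐ x ∂unif, |u x| ≤ c) (i : ℤ) : Integrable (fun ω => u (U i ω)) P :=
  Integrable.of_bound (hu.comp (h.measurable_U i)).aestronglyMeasurable c (h.ae_comp i hc)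

theorem integral_centered_mul (h : IsRandomDesign P U ε) {u : ℝ → ℝ} (hu : Measurable u)
    {c : ℝ} (hc : ∀ᵐ x ∂unif, |u x| ≤ c) (i l : ℤ) :
    ∫ ω, (u (U i ω) - ∫ x, u x ∂unif) * (u (U l ω) - ∫ x, u x ∂unif) ∂P =
      ∫ ω, u (U i ω) * u (U l ω) ∂P - (∫ x, u x ∂unif) ^ 2 := by
  set θ := ∫ x, u x ∂unif with hθ
  have h1 := h.integrable_mul_comp hu hu hc hc i l
  have h2 := (h.integrable_comp hu hc i).const_mul (-θ)
  have h3 := (h.integrable_comp hu hc l).const_mul (-θ)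
  have e : ∀ ω, (u (U i ω) - θ) * (u (U l ω) - θ) =
      u (U i ω) * u (U l ω) + -θ * u (U i ω) + (-θ * u (U l ω) + θ ^ 2) := fun ω => by ring
  simp_rw [e]
  rw [integral_add_add h1 h2 h3 (integrable_const _), integral_const_mul, integral_const_mul,
    h.integral_comp i hu, h.integral_comp l hu, ← hθ]
  simp
  ring

/-- The second moments of the summands of a centred empirical coefficient. -/
theorem integral_summand_mul (h : IsRandomDesign P U ε) {u v : ℝ → ℝ} (hu : Measurable u)
    (hv : Measurable v) {c c' : ℝ} (hc : ∀ᵐ x ∂unif, |u x| ≤ c) (hc' : ∀ᵐ x ∂unif, |v x| ≤ c')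
    (hv1 : ∫ x, v x * v x ∂unif = 1) (σ : ℝ) (i l : ℕ) :
    Integrable (fun ω => (u (U i ω) + σ * ε i ω * v (U i ω) - ∫ x, u x ∂unif) *
      (u (U l ω) + σ * ε l ω * v (U l ω) - ∫ x, u x ∂unif)) P ∧
    ∫ ω, (u (U i ω) + σ * ε i ω * v (U i ω) - ∫ x, u x ∂unif) *
      (u (U l ω) + σ * ε l ω * v (U l ω) - ∫ x, u x ∂unif) ∂P =
      ∫ ω, u (U i ω) * u (U l ω) ∂P - (∫ x, u x ∂unif) ^ 2 + if i = l then σ ^ 2 else 0 := by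
  have hcent := h.integral_centered_mul hu hc i l
  set θ := ∫ x, u x ∂unif with hθ
  have hu' : Measurable fun x => u x - θ := hu.sub_const _
  have hb : ∀ᵐ x ∂unif, |u x - θ| ≤ c + |θ| := hc.mono fun x hx => (abs_sub _ _).trans (by gcongr)
  have hd1 : Measurable fun x : ℤ → ℝ => (u (x i) - θ) * v (x l) :=
    (hu'.comp (measurable_pi_apply _)).mul (hv.comp (measurable_pi_apply _))
  have hd2 : Measurable fun x : ℤ → ℝ => (u (x l) - θ) * v (x i) :=
    (hu'.comp (measurable_pi_apply _)).mul (hv.comp (measurable_pi_apply _))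
  have hd3 : Measurable fun x : ℤ → ℝ => v (x i) * v (x l) :=
    (hv.comp (measurable_pi_apply _)).mul (hv.comp (measurable_pi_apply _))
  have i0 := h.integrable_mul_comp hu' hu' hb hb i l
  have i1 := (h.integrable_mul_noise hd1 (h.integrable_mul_comp hu' hv hb hc' i l) l).const_mul σ
  have i2 := (h.integrable_mul_noise hd2 (h.integrable_mul_comp hu' hv hb hc' l i) i).const_mul σ
  have i3 := (h.integrable_mul_noise_mul_noise hd3
    (h.integrable_mul_comp hv hv hc' hc' i l) i l).const_mul (σ ^ 2)
  -- Design and noise parts are separated. The two mixed terms have mean zero, as the noise is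
  -- centred and independent of the design; the last term survives only for `i = l`, where it equals
  -- `σ ^ 2` by the normalisation of `v`.
  have e : ∀ ω, (u (U i ω) + σ * ε i ω * v (U i ω) - θ) *
      (u (U l ω) + σ * ε l ω * v (U l ω) - θ) =
      (u (U i ω) - θ) * (u (U l ω) - θ) + σ * ((u (U i ω) - θ) * v (U l ω) * ε l ω)
      + (σ * ((u (U l ω) - θ) * v (U i ω) * ε i ω)
      + σ ^ 2 * (v (U i ω) * v (U l ω) * (ε i ω * ε l ω))) := fun ω => by ring
  simp_rw [e]
  refine ⟨(i0.add i1).add (i2.add i3), ?_⟩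
  refine (integral_add_add i0 i1 i2 i3).trans ?_
  rw [integral_const_mul, integral_const_mul, integral_const_mul, h.integral_mul_noise hd1,
    h.integral_mul_noise hd2, h.integral_mul_noise_mul_noise hd3, hcent]
  split_ifs with hil
  · subst hil
    rw [h.integral_comp (u := fun x => v x * v x) i (hv.mul hv), hv1]
    ring
  · ring

end IsRandomDesign

end

/-! ### From covariances to the risk bound -/

theorem sum_filter_comp_le {D : ℕ → ℝ} (hD : ∀ k, 0 ≤ D k) {n : ℕ} (s : Finset ℕ) {g : ℕ → ℕ}
    (hg : Set.InjOn g s) (hmem : ∀ l ∈ s, g l ∈ Finset.Icc 1 n) :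
    ∑ l ∈ s, D (g l) ≤ ∑ k ∈ Finset.Icc 1 n, D k := by
  classical
  rw [← Finset.sum_image hg]
  exact Finset.sum_le_sum_of_subset_of_nonneg (Finset.image_subset_iff.2 hmem) fun k _ _ => hD k

/-- In each row, every distance `k ≥ 1` occurs at most once on either side of the diagonal. -/
theorem sum_sum_le_of_le_dist {D : ℕ → ℝ} (hD : ∀ k, 0 ≤ D k) {c : ℕ → ℕ → ℝ} {b : ℝ} (n : ℕ)
    (hb : ∀ i, c i i ≤ b) (h1 : ∀ i l, i < l → c i l ≤ D (l - i))
    (h2 : ∀ i l, l < i → c i l ≤ D (i - l)) :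
    ∑ i ∈ Finset.Icc 1 n, ∑ l ∈ Finset.Icc 1 n, c i l ≤
      n * (b + 2 * ∑ k ∈ Finset.Icc 1 n, D k) := by
  have key : ∀ i ∈ Finset.Icc 1 n, ∑ l ∈ Finset.Icc 1 n, c i l ≤
      b + 2 * ∑ k ∈ Finset.Icc 1 n, D k := by
    intro i hi
    have hpt : ∀ l ∈ Finset.Icc 1 n, c i l ≤ (if i = l then b else 0) +
        ((if l < i then D (i - l) else 0) + (if i < l then D (l - i) else 0)) := by
      intro l _
      rcases lt_trichotomy i l with h | h | h
      · simpa [h, h.ne, h.not_gt] using h1 i l h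
      · subst h; simpa using hb i
      · simpa [h, h.ne', h.not_gt] using h2 i l h
    refine (Finset.sum_le_sum hpt).trans ?_
    rw [Finset.sum_add_distrib, Finset.sum_add_distrib, Finset.sum_ite_eq, if_pos hi,
      ← Finset.sum_filter, ← Finset.sum_filter, two_mul]
    simp only [Finset.mem_Icc] at hi
    refine add_le_add le_rfl (add_le_add ?_ ?_)
    · refine sum_filter_comp_le hD _ (g := fun l => i - l) ?_ ?_
      · intro a ha a' ha' hh
        simp only [Finset.coe_filter, Finset.mem_Icc, Set.mem_ofPred_eq] at ha ha' hh
        omega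
      · intro l hl
        simp only [Finset.mem_filter, Finset.mem_Icc] at hl ⊢
        omega
    · refine sum_filter_comp_le hD _ (g := fun l => l - i) ?_ ?_
      · intro a ha a' ha' hh
        simp only [Finset.coe_filter, Finset.mem_Icc, Set.mem_ofPred_eq] at ha ha' hh
        omega
      · intro l hl
        simp only [Finset.mem_filter, Finset.mem_Icc] at hl ⊢
        omega
  refine (Finset.sum_le_sum key).trans_eq ?_
  rw [Finset.sum_const, Nat.card_Icc, add_tsub_cancel_right, nsmul_eq_mul]

section

variable {Ω : Type*} [MeasurableSpace Ω] {P : Measure Ω} {U : ℤ → Ω → ℝ} {ε : ℕ → Ω → ℝ}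
  {φ : ℕ+ → L2I} {f : L2I} {R τ : ℝ}

theorem covSum_comm (X Y : Ω → ℝ) (m : ℕ+) : covSum P φ f m X Y = covSum P φ f m Y X :=
  Finset.sum_congr rfl fun j _ => by
    congr 1
    exact integral_congr_ae (ae_of_all _ fun ω => mul_comm _ _)

namespace IsRandomDesign

/-- The squared means are dropped and the sum of the `φ j ^ 2` is bounded pointwise. This leaves
`‖f‖ ^ 2`, so the final constant contains `r ^ 2` and not `R ^ 2`. -/
theorem covSum_self_le (h : IsRandomDesign P U ε) (h1 : CondA1 φ τ)
    (hf : ∀ᵐ x ∂unif, |f x| ≤ R) (m : ℕ+) (i : ℤ) :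
    covSum P φ f m (U i) (U i) ≤ τ ^ 2 * (m : ℕ) * ‖f‖ ^ 2 := by
  have hi : ∀ j ∈ Finset.Icc 1 m,
      Integrable (fun x => f x * φ j x * (f x * φ j x)) unif := fun j hj => by
    refine Integrable.of_bound ((measurable_mul_basis f φ j).mul
      (measurable_mul_basis f φ j)).aestronglyMeasurable
      (R * (|τ| * √(m : ℕ)) * (R * (|τ| * √(m : ℕ)))) ?_
    filter_upwards [ae_abs_mul_basis_le (m := m) h1 hf] with x hx
    rw [norm_mul]
    exact mul_le_mul (hx j hj) (hx j hj) (norm_nonneg _) ((abs_nonneg _).trans (hx j hj))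
  calc covSum P φ f m (U i) (U i)
      ≤ ∑ j ∈ Finset.Icc 1 m, ∫ x, f x * φ j x * (f x * φ j x) ∂unif := by
        refine Finset.sum_le_sum fun j _ => ?_
        rw [h.integral_comp i (u := fun x => f x * φ j x * (f x * φ j x))
          ((measurable_mul_basis f φ j).mul (measurable_mul_basis f φ j))]
        exact sub_le_self _ (sq_nonneg _)
    _ = ∫ x, ∑ j ∈ Finset.Icc 1 m, f x * φ j x * (f x * φ j x) ∂unif :=
        (integral_finsetSum _ hi).symm
    _ ≤ ∫ x, τ ^ 2 * (m : ℕ) * (f x * f x) ∂unif := by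
        refine integral_mono_ae (integrable_finsetSum _ hi)
          ((integrable_coeFn_mul f f).const_mul _) ?_
        filter_upwards [h1.ae_sum_sq_le m] with x hx
        have e : ∑ j ∈ Finset.Icc 1 m, f x * φ j x * (f x * φ j x) =
            (∑ j ∈ Finset.Icc 1 m, φ j x ^ 2) * (f x * f x) := by
          rw [Finset.sum_mul]
          exact Finset.sum_congr rfl fun j _ => by ring
        rw [e]
        exact mul_le_mul_of_nonneg_right hx (mul_self_nonneg _)
    _ = τ ^ 2 * (m : ℕ) * ‖f‖ ^ 2 := by
        rw [integral_const_mul, integral_mul_eq_inner, real_inner_self_eq_norm_sq]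

theorem covSum_le (h : IsRandomDesign P U ε) (m : ℕ+) {i l : ℕ} (hil : i < l) :
    covSum P φ f m (U i) (U l) ≤ |covSum P φ f m (U 0) (U (l - i : ℕ))| := by
  have := h.covSum_shift φ f m i (l - i : ℕ)
  rw [Nat.cast_sub hil.le, sub_add_cancel] at this
  rw [this, Nat.cast_sub hil.le]
  exact le_abs_self _

end IsRandomDesign

/-- The `i`-th summand of the centred `j`-th empirical coefficient. -/
noncomputable def summand (U : ℤ → Ω → ℝ) (ε : ℕ → Ω → ℝ) (σ : ℝ) (φ : ℕ+ → L2I) (f : L2I)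
    (j : ℕ+) (i : ℕ) (ω : Ω) : ℝ :=
  f (U i ω) * φ j (U i ω) + σ * ε i ω * φ j (U i ω) - ∫ x, f x * φ j x ∂unif

omit [MeasurableSpace Ω] in
theorem norm_sq_seriesEst_sub (hφ : Orthonormal ℝ φ) {n : ℕ} (hn : 1 ≤ n) (m : ℕ+) (σ : ℝ)
    (ω : Ω) :
    ‖seriesEst φ n m (fun i => f (U i ω) + σ * ε i ω) (fun i => U i ω) - f‖ ^ 2 =
      ((n : ℝ)⁻¹) ^ 2 *
        ∑ j ∈ Finset.Icc 1 m, (∑ i ∈ Finset.Icc 1 n, summand U ε σ φ f j i ω) ^ 2 +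
      ‖f - ∑ j ∈ Finset.Icc 1 m, (inner ℝ (φ j) f : ℝ) • φ j‖ ^ 2 := by
  have hn' : (n : ℝ) ≠ 0 := by positivity
  rw [seriesEst, norm_sq_sum_smul_sub hφ, Finset.mul_sum]
  congr 1
  refine Finset.sum_congr rfl fun j _ => ?_
  rw [← mul_pow]
  congr 1
  simp only [coefEst, summand, Finset.sum_sub_distrib, Finset.sum_const, Nat.card_Icc,
    add_tsub_cancel_right, nsmul_eq_mul, integral_mul_eq_inner, real_inner_comm]
  rw [mul_sub, inv_mul_cancel_left₀ hn']
  congr 2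
  exact Finset.sum_congr rfl fun i _ => by ring

variable [IsProbabilityMeasure P]

/-- The sum over `j` is moved innermost, so that it forms `covSum`; the noise adds `σ ^ 2` for each
`j`, on the diagonal only. -/
theorem integral_sum_sq_summand (h : IsRandomDesign P U ε) (hφ : Orthonormal ℝ φ)
    (h1 : CondA1 φ τ) (hf : ∀ᵐ x ∂unif, |f x| ≤ R) (σ : ℝ) (n : ℕ) (m : ℕ+) :
    Integrable (fun ω => ∑ j ∈ Finset.Icc 1 m,
      (∑ i ∈ Finset.Icc 1 n, summand U ε σ φ f j i ω) ^ 2) P ∧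
    ∫ ω, ∑ j ∈ Finset.Icc 1 m, (∑ i ∈ Finset.Icc 1 n, summand U ε σ φ f j i ω) ^ 2 ∂P =
      ∑ i ∈ Finset.Icc 1 n, ∑ l ∈ Finset.Icc 1 n,
        (covSum P φ f m (U i) (U l) + if i = l then (m : ℕ) * σ ^ 2 else 0) := by
  have hs : ∀ j ∈ Finset.Icc 1 m, ∀ i l : ℕ,
      Integrable (fun ω => summand U ε σ φ f j i ω * summand U ε σ φ f j l ω) P ∧
      ∫ ω, summand U ε σ φ f j i ω * summand U ε σ φ f j l ω ∂P =
        ∫ ω, f (U i ω) * φ j (U i ω) * (f (U l ω) * φ j (U l ω)) ∂P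
          - inner ℝ (φ j) f ^ 2 + if i = l then σ ^ 2 else 0 := fun j hj i l => by
    have := h.integral_summand_mul (measurable_mul_basis f φ j) (measurable_coeFn (φ j))
      ((ae_abs_mul_basis_le h1 hf).mono fun x hx => hx j hj)
      ((ae_abs_basis_le h1).mono fun x hx => hx j hj)
      (by rw [integral_mul_eq_ite hφ, if_pos rfl]) σ i l
    have e : ∫ x, f x * φ j x ∂unif = inner ℝ (φ j) f := by
      rw [integral_mul_eq_inner, real_inner_comm]
    refine ⟨this.1, ?_⟩
    rw [← e]
    exact this.2
  have e : ∀ ω, ∑ j ∈ Finset.Icc 1 m, (∑ i ∈ Finset.Icc 1 n, summand U ε σ φ f j i ω) ^ 2 =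
      ∑ j ∈ Finset.Icc 1 m, ∑ i ∈ Finset.Icc 1 n, ∑ l ∈ Finset.Icc 1 n,
        summand U ε σ φ f j i ω * summand U ε σ φ f j l ω := fun ω => by
    simp_rw [sq, Finset.sum_mul_sum]
  simp_rw [e]
  have i1 : ∀ j ∈ Finset.Icc 1 m, ∀ i, Integrable (fun ω => ∑ l ∈ Finset.Icc 1 n,
      summand U ε σ φ f j i ω * summand U ε σ φ f j l ω) P := fun j hj i =>
    integrable_finsetSum _ fun l _ => (hs j hj i l).1
  have i2 : ∀ j ∈ Finset.Icc 1 m, Integrable (fun ω => ∑ i ∈ Finset.Icc 1 n,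
      ∑ l ∈ Finset.Icc 1 n, summand U ε σ φ f j i ω * summand U ε σ φ f j l ω) P := fun j hj =>
    integrable_finsetSum _ fun i _ => i1 j hj i
  refine ⟨integrable_finsetSum _ i2, ?_⟩
  rw [integral_finsetSum _ i2]
  rw [Finset.sum_congr rfl fun j hj => (integral_finsetSum _ fun i _ => i1 j hj i).trans
    (Finset.sum_congr rfl fun i _ => (integral_finsetSum _ fun l _ => (hs j hj i l).1).trans
      (Finset.sum_congr rfl fun l _ => (hs j hj i l).2)), Finset.sum_comm]
  refine Finset.sum_congr rfl fun i _ => ?_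
  rw [Finset.sum_comm]
  refine Finset.sum_congr rfl fun l _ => ?_
  rw [Finset.sum_add_distrib, covSum]
  congr 1
  simp

/-- The bias-variance bound on the risk of the series estimator. -/
theorem risk_le (h : IsRandomDesign P U ε) (hφ : Orthonormal ℝ φ) (h1 : CondA1 φ τ)
    (hf : ∀ᵐ x ∂unif, |f x| ≤ R) (σ : ℝ) {n : ℕ} (hn : 1 ≤ n) (m : ℕ+) :
    risk P U ε σ φ n m f ≤ ENNReal.ofReal
      ((m * σ ^ 2 + τ ^ 2 * (m : ℕ) * ‖f‖ ^ 2 +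
        2 * ∑ k ∈ Finset.Icc 1 n, |covSum P φ f m (U 0) (U (k : ℕ))|) / n +
      ‖f - ∑ j ∈ Finset.Icc 1 m, (inner ℝ (φ j) f : ℝ) • φ j‖ ^ 2) := by
  have hn' : (n : ℝ) ≠ 0 := by positivity
  obtain ⟨hint, heq⟩ := integral_sum_sq_summand h hφ h1 hf σ n m
  have e : ∀ ω, ‖seriesEst φ n m (fun i => f (U i ω) + σ * ε i ω) (fun i => U i ω) - f‖ₑ ^ 2 =
      ENNReal.ofReal (((n : ℝ)⁻¹) ^ 2 *
        ∑ j ∈ Finset.Icc 1 m, (∑ i ∈ Finset.Icc 1 n, summand U ε σ φ f j i ω) ^ 2 +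
      ‖f - ∑ j ∈ Finset.Icc 1 m, (inner ℝ (φ j) f : ℝ) • φ j‖ ^ 2) := fun ω => by
    rw [← norm_sq_seriesEst_sub hφ hn, ENNReal.ofReal_pow (norm_nonneg _), ofReal_norm]
  have hint' : Integrable (fun ω => ((n : ℝ)⁻¹) ^ 2 *
        ∑ j ∈ Finset.Icc 1 m, (∑ i ∈ Finset.Icc 1 n, summand U ε σ φ f j i ω) ^ 2 +
      ‖f - ∑ j ∈ Finset.Icc 1 m, (inner ℝ (φ j) f : ℝ) • φ j‖ ^ 2) P :=
    (hint.const_mul _).add (integrable_const _)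
  rw [risk, lintegral_congr e, ← ofReal_integral_eq_lintegral_ofReal hint' (ae_of_all _ fun ω => by positivity)]
  refine ENNReal.ofReal_le_ofReal ?_
  rw [integral_add (hint.const_mul _) (integrable_const _), integral_const_mul, heq]
  have hbd := sum_sum_le_of_le_dist (D := fun k : ℕ => |covSum P φ f m (U 0) (U (k : ℕ))|)
    (fun _ => abs_nonneg _)
    (c := fun i l => covSum P φ f m (U i) (U l) + if i = l then ((m : ℕ) : ℝ) * σ ^ 2 else 0)
    (b := m * σ ^ 2 + τ ^ 2 * (m : ℕ) * ‖f‖ ^ 2) n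
    (fun i => by
      rw [if_pos rfl, add_comm]
      exact add_le_add le_rfl (h.covSum_self_le h1 hf m i))
    (fun i l hil => by
      rw [if_neg hil.ne, add_zero]
      exact h.covSum_le m hil)
    (fun i l hil => by
      rw [if_neg hil.ne', add_zero, covSum_comm]
      exact h.covSum_le m hil)
  refine add_le_add ?_ (by simp)
  refine (mul_le_mul_of_nonneg_left hbd (by positivity)).trans_eq ?_
  field_simp

end

/-! ### Splitting the lags and choosing the threshold -/

theorem sum_le_of_head_tail {D b : ℕ+ → ℝ} {x y η : ℝ} (F : Finset ℕ+) (hx : 0 ≤ x) (hy : 0 ≤ y)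
    (h1 : ∀ k, D k ≤ x) (h2 : ∀ k, D k ≤ y * b k)
    (hη : ∀ t : Finset ℕ+, Disjoint t F → ∑ k ∈ t, b k ≤ η) (s : Finset ℕ+) :
    ∑ k ∈ s, D k ≤ F.card * x + y * η := by
  classical
  rw [← Finset.sum_inter_add_sum_sdiff s F]
  refine add_le_add ?_ ?_
  · refine (Finset.sum_le_card_nsmul _ _ x fun k _ => h1 k).trans ?_
    rw [nsmul_eq_mul]
    gcongr
    exact Finset.inter_subset_right
  · refine (Finset.sum_le_sum fun k _ => h2 k).trans ?_
    rw [← Finset.mul_sum]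
    exact mul_le_mul_of_nonneg_left (hη _ Finset.sdiff_disjoint) hy

theorem sum_Icc_eq_sum_image_toPNat (D : ℕ → ℝ) (n : ℕ) :
    ∑ k ∈ Finset.Icc 1 n, D k = ∑ k ∈ (Finset.Icc 1 n).image Nat.toPNat', D (k : ℕ) := by
  have hpos : ∀ k ∈ Finset.Icc 1 n, ((k.toPNat' : ℕ+) : ℕ) = k := fun k hk => by
    rw [Nat.toPNat'_coe, if_pos (Nat.succ_le_iff.1 (Finset.mem_Icc.1 hk).1)]
  rw [Finset.sum_image]
  · exact Finset.sum_congr rfl fun k hk => by rw [hpos k hk]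
  · intro a ha a' ha' hh
    rw [← hpos a ha, ← hpos a' ha', hh]

theorem IsRandomDesign.isUniformPair {Ω : Type*} [MeasurableSpace Ω] {P : Measure Ω}
    {U : ℤ → Ω → ℝ} {ε : ℕ → Ω → ℝ} (h : IsRandomDesign P U ε) {G : ℝ≥0} (hG : CondD2 P U G)
    (k : ℕ+) : ∃ g, IsUniformPair P (U 0) (U (k : ℕ)) g ∧
      eLpNorm (fun z => g z - 1) 2 (unif.prod unif) ≤ G := by
  obtain ⟨g, hg, hsup⟩ := hG
  obtain ⟨h1, h2, h3⟩ := hg k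
  exact ⟨g k, ⟨h.measurable_U _, h.measurable_U _, h.uniform _, h.uniform _, h1, h2, h3⟩,
    (le_iSup (fun k => eLpNorm (fun z => g k z - 1) 2 (unif.prod unif)) k).trans hsup⟩

end DepReg

open DepReg
theorem mainTheorem10
    -- the weights
    (w : ℕ+ → ℝ) (hw_pos : ∀ j, 0 < w j) (hw_one : w 1 ≤ 1)
    -- the mixing coefficients, the bound on the pair densities, and the product `r * A`
    (b : ℕ+ → ℝ≥0∞) (hb : (∑' k, b k) < ∞) (G : ℝ≥0) (R : ℝ) :
    ∃ n₀ : ℕ, 1 ≤ n₀ ∧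
      ∀ (φ : ℕ+ → L2I) (τ A r σ : ℝ), Orthonormal ℝ φ → 1 ≤ τ → 1 ≤ A → 0 < r → 0 < σ →
        r * A = R → CondA1 φ τ → CondA2 w φ A →
      ∀ (Ω : Type*) [MeasurableSpace Ω] (P : Measure Ω) [IsProbabilityMeasure P]
        (U : ℤ → Ω → ℝ) (ε : ℕ → Ω → ℝ), IsRandomDesign P U ε →
        (∀ k : ℕ+, betaRV P (U 0) (U (k : ℕ)) = b k) → CondD2 P U G →
      ∀ n : ℕ, n₀ ≤ n →
        maxRisk P U ε σ φ n (oracleDim w n) (funClass w φ r ∩ spanClosure φ) ≤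
          ENNReal.ofReal ((σ ^ 2 + (r ^ 2 + 1) * τ ^ 2 + r ^ 2) * oracleRate w n) := by
  -- The threshold must be chosen before `φ` is given, while monotonicity and convergence of `w`
  -- come with `CondA2`. If they fail, no admissible system exists and any threshold works.
  by_cases hw : Antitone w ∧ Tendsto w atTop (𝓝 0)
  swap
  · exact ⟨1, le_rfl, fun φ τ A r σ _ _ _ _ _ _ _ h2 =>
      absurd ⟨h2.antitone, h2.tendsto_zero⟩ hw⟩
  obtain ⟨hanti, hlim⟩ := hw
  have hbtop : ∀ k, b k ≠ ∞ := ENNReal.ne_top_of_tsum_ne_top hb.ne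
  -- Chosen so that `4 * R ^ 2 * η ≤ 1 / 4`; the `+ 1` keeps it positive and finite for every `R`.
  set η : ℝ := (16 * (R ^ 2 + 1))⁻¹ with hη
  have hηpos : 0 < η := by positivity
  obtain ⟨F, hF⟩ := summable_iff_vanishing_norm.1 (ENNReal.summable_toReal hb.ne) η hηpos
  -- For `m ≥ M` the lags in `F` contribute at most `card F * R ^ 2 * (1 + G ^ 2) * √m ≤ m / 4`.
  obtain ⟨M, hM⟩ := exists_nat_ge ((4 * (F.card * (R ^ 2 * (1 + (G : ℝ) ^ 2)))) ^ 2)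
  obtain ⟨N, hN⟩ := eventually_atTop.1 (eventually_le_oracleDim hw_pos hanti hlim M.succPNat)
  refine ⟨max N 1, le_max_right _ _, ?_⟩
  intro φ τ A r σ hφ hτ hA hr _ hR h1 h2 Ω _ P _ U ε h hβ hG n hn
  have hn1 : 1 ≤ n := (le_max_right _ _).trans hn
  have hnpos : (0 : ℝ) < n := by exact_mod_cast hn1
  set m := oracleDim w n with hm
  have hmM : (M : ℝ) ≤ (m : ℕ) := by
    have h3 : M.succPNat ≤ m := hN n ((le_max_left _ _).trans hn)
    have h4 : M + 1 ≤ (m : ℕ) := by exact_mod_cast h3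
    exact_mod_cast (Nat.le_succ M).trans h4
  have hsqrt : 4 * (F.card * (R ^ 2 * (1 + (G : ℝ) ^ 2))) ≤ √(m : ℕ) :=
    Real.le_sqrt_of_sq_le (hM.trans hmM)
  have hmpos : (0 : ℝ) < (m : ℕ) := by exact_mod_cast m.pos
  refine iSup₂_le fun f hfmem => ?_
  have hf := mem_ellipsoid_of_mem hfmem
  have hfR : ∀ᵐ x ∂unif, |f x| ≤ R := by
    rw [← hR]
    exact ae_abs_le_of_mem_ellipsoid hφ hw_pos h2 hr.le (zero_le_one.trans hA) hf
  have hnorm := norm_sq_le_of_mem_ellipsoid hφ hw_pos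
    (fun j => (hanti one_le).trans hw_one) hf
  have hbias := bias_sq_le_of_mem_ellipsoid hφ hw_pos hanti hf m
  -- Lags in `F` and lags outside it each get a quarter of `τ ^ 2 * m`; the factor `2` leaves a
  -- total of half that amount. The head bound uses `1 ≤ τ`.
  have hcov : 2 * ∑ k ∈ Finset.Icc 1 n, |covSum P φ f m (U 0) (U (k : ℕ))| ≤ τ ^ 2 * (m : ℕ) := by
    rw [sum_Icc_eq_sum_image_toPNat fun k => |covSum P φ f m (U 0) (U (k : ℕ))|]
    have hsum := sum_le_of_head_tail (D := fun k : ℕ+ => |covSum P φ f m (U 0) (U (k : ℕ))|)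
      (b := fun k => (b k).toReal) (x := R ^ 2 * (1 + (G : ℝ) ^ 2) * √(m : ℕ))
      (y := 4 * R ^ 2 * (τ ^ 2 * (m : ℕ))) F (by positivity) (by positivity)
      (fun k => by
        obtain ⟨g, hg, hgG⟩ := h.isUniformPair hG k
        exact hg.abs_covSum_le_sqrt hφ h1 hfR hgG)
      (fun k => by
        obtain ⟨g, hg, -⟩ := h.isUniformPair hG k
        have := hg.abs_covSum_le_betaRV (m := m) h1 hfR (by rw [hβ]; exact hbtop k)
        rw [hβ] at this
        linarith)
      (fun t ht => (le_abs_self _).trans (hF t ht).le)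
      ((Finset.Icc 1 n).image Nat.toPNat')
    have hhead : F.card * (R ^ 2 * (1 + (G : ℝ) ^ 2) * √(m : ℕ)) ≤ τ ^ 2 * (m : ℕ) / 4 := by
      have h3 := mul_le_mul_of_nonneg_right hsqrt (Real.sqrt_nonneg (m : ℕ))
      rw [Real.mul_self_sqrt hmpos.le] at h3
      have h4 : ((m : ℕ) : ℝ) ≤ τ ^ 2 * (m : ℕ) :=
        le_mul_of_one_le_left hmpos.le (one_le_pow₀ hτ)
      linarith
    have htail : 4 * R ^ 2 * (τ ^ 2 * (m : ℕ)) * η ≤ τ ^ 2 * (m : ℕ) / 4 := by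
      have h3 : 4 * R ^ 2 * η ≤ 1 / 4 := by
        rw [hη, ← div_eq_mul_inv, div_le_iff₀ (by positivity)]
        linarith
      have h4 := mul_le_mul_of_nonneg_right h3 (by positivity : 0 ≤ τ ^ 2 * ((m : ℕ) : ℝ))
      linarith
    linarith
  refine (risk_le h hφ h1 hfR σ hn1 m).trans (ENNReal.ofReal_le_ofReal ?_)
  have hδ1 : w m ≤ oracleRate w n := le_max_left _ _
  have hδ2 : (m : ℕ) / (n : ℝ) ≤ oracleRate w n := le_max_right _ _
  -- The three terms of the constant come from the noise (`σ ^ 2`), the diagonal (`r ^ 2 * τ ^ 2`)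
  -- and the covariances (`τ ^ 2`); the bias adds the remaining `r ^ 2`.
  have hvar : (m * σ ^ 2 + τ ^ 2 * (m : ℕ) * ‖f‖ ^ 2 +
      2 * ∑ k ∈ Finset.Icc 1 n, |covSum P φ f m (U 0) (U (k : ℕ))|) / n ≤
      (σ ^ 2 + (r ^ 2 + 1) * τ ^ 2) * oracleRate w n := by
    refine le_trans ?_ (mul_le_mul_of_nonneg_left hδ2 (by positivity))
    rw [mul_div_assoc', div_le_div_iff_of_pos_right hnpos]
    have h3 := mul_le_mul_of_nonneg_left hnorm (by positivity : 0 ≤ τ ^ 2 * ((m : ℕ) : ℝ))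
    linarith
  have hb2 := mul_le_mul_of_nonneg_right hδ1 (sq_nonneg r)
  linarith
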